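/- Let $r\ge 2$ and let $n,m\ge 1$ be coprime integers. For an $r$-uniform hypergraph and a finite set $A$ of its vertices, let $R[A]$ be the set of hyperedges contained in $A$ and $\delta(A)=n|A|-m|R[A]|$. For finite $A\subseteq B$ write $A\le B$ if $\delta(A)\le\delta(B')$ whenever $A\subseteq B'\subseteq B$. Let $\mathcal C_0$ be the class of finite $r$-uniform hypergraphs $B$ with $\emptyset\le B$. If all finite (induced) substructures of $M$ are in $\mathcal C_0$ and $C\subseteq M$, write $C\le M$ if $X\cap C\le X$ for all finite $X\subseteq M$. Let $M_0$ be the generic structure for $(\mathcal C_0,\le)$, i.e. a countable $r$-uniform hypergraph all of whose finite substructures are in $\mathcal C_0$, which is the union of a chain of finite $\le$-substructures, and such that whenever $X\le M_0$ is finite and $X\le A\in\mathcal C_0$ there is an embedding $\alpha:A\to M_0$ which is the identity on $X$ and satisfies $\alpha(A)\le M_0$. (These properties determine $M_0$ up to isomorphism.) Let $G={\rm Aut}(M_0)$ and, for $B \subseteq M_0$, let $G_B$ be its pointwise stabilizer of $B$. For finite $X\subseteq M_0$ let ${\rm cl}_0(X)$ be the smallest $Y$ with $X\subseteq Y\le M_0$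 (it is finite), and $d(X)=\delta({\rm cl}_0(X))$. For finite $X$ and arbitrary $Z$ put $d(X/Z)=\min\{d(X\cup Y)-d(Y): Y\subseteq Z\text{ finite}\}$, and ${\rm cl}^d(Z)=\{a\in M_0: d(\{a\}/Z)=0\}$. Let $\mathcal X=\{{\rm cl}^d(X): X\subseteq M_0\text{ finite}\}$. For $A\in\mathcal X$ and arbitrary $Z$ put $d(A/Z)=\max\{d(X/Z): X\subseteq A\text{ finite}\}$, and for $A,B,C\in\mathcal X$ say that $A$ and $C$ are $d$-independent over $B$ if $d(A/B\cup C)=d(A/B)$. A partial automorphism is a bijection between two elements of $\mathcal X$ which extends to an element of $G$. Then: 1. ($d$-homogeneity) If $A_1,A_2\in\mathcal X$, then every isomorphism $h:A_1\to A_2$ extends to an automorphism of $M_0$. 2. ($d$-stationarity) Let $A_1,A_2,C\in\mathcal X$ with $A_1\cap C=A_2\cap C=B$ and, for $i=1,2$, $A_i\cup C\le M_0$ and every hyperedge contained in $A_i\cup C$ is contained in $A_i$ or in $C$. Then every isomorphism $h:A_1\to A_2$ which is the identity on $B$ extends to an automorphism of $M_0$ fixing $C$ pointwise. 3. $d$ is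 a non-zero integer-valued dimension function: $d(\emptyset)=0$, $d\neq 0$, $d(gX)=d(X)$ for all $g\in G$, and $0\le d(X)\le d(X\cup Y)\le d(X)+d(Y)-d(X\cap Y)$ for all finite $X,Y\subseteq M_0$. 4. ${\rm cl}^d$ subsumes definable closure: if $X\subseteq M_0$ is finite and $a\in M_0$ is fixed by $G_{{\rm cl}^d(X)}$, then $a\in{\rm cl}^d(X)$. 5. (Existence) For all $A,B,C\in\mathcal X$ there is $g\in G_B$ such that $gA$ and $C$ are $d$-independent over $B$. 6. ($d$-independence is stationary) Let $A_1,A_2,B,C\in\mathcal X$ with $B\subseteq A_i$ and $A_i$, $C$ $d$-independent over $B$ for $i=1,2$. If $h:A_1\to A_2$ is a partial automorphism which is the identity on $B$, then there is a partial automorphism which extends both $h$ and the identity map of $C$. -/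

import Mathlib

namespace Hrushovski

universe u v

/-! ### Uniform hypergraphs, substructures, isomorphisms -/

/-- An `r`-uniform hypergraph on `V`, given by its set of hyperedges. This is the same thing as an
`r`-ary relation on `V` which is symmetric and only holds of tuples with distinct entries. -/
structure Hypergraph (r : ℕ) (V : Type u) where
  edges : Set (Finset V)
  card_edge : ∀ e ∈ edges, e.card = r

variable {r : ℕ} {V : Type u} {W : Type v}

namespace Hypergraph

/-- The (induced) substructure on a subset. -/
def induce (M : Hypergraph r V) (A : Set V) : Hypergraph r A where
  edges := {e | e.map (Function.Embedding.subtype _) ∈ M.edges}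
  card_edge := fun e he => by
    have h := M.card_edge _ he
    rwa [Finset.card_map] at h

/-- The injection `f` is an embedding of structures (onto an induced substructure). For a bijection
`f` this says that `f` is an isomorphism. -/
def IsEmb (M : Hypergraph r V) (N : Hypergraph r W) (f : V ↪ W) : Prop :=
  ∀ e : Finset V, e ∈ M.edges ↔ e.map f ∈ N.edges

/-- `h` is an isomorphism between the substructures of `M` on `A₁` and on `A₂`. -/
def IsIsoBetween (M : Hypergraph r V) {A₁ A₂ : Set V} (h : A₁ ≃ A₂) : Prop :=
  (M.induce A₁).IsEmb (M.induce A₂) h.toEmbedding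

/-- The automorphism group of a hypergraph, as a group of permutations. -/
def aut (M : Hypergraph r V) : Subgroup (Equiv.Perm V) where
  carrier := {g | M.IsEmb M g.toEmbedding}
  one_mem' := by
    intro e
    have : e.map (1 : Equiv.Perm V).toEmbedding = e := Finset.map_refl
    rw [this]
  mul_mem' := by
    intro g h hg hh e
    have : e.map (g * h).toEmbedding = (e.map h.toEmbedding).map g.toEmbedding := by
      rw [Finset.map_map]
      rfl
    rw [this, ← hg, ← hh]
  inv_mem' := by
    intro g hg e
    have : (e.map (g⁻¹).toEmbedding).map g.toEmbedding = e := by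
      rw [Finset.map_map]
      have h : (g⁻¹).toEmbedding.trans g.toEmbedding = Function.Embedding.refl V := by
        ext x
        exact g.apply_symm_apply x
      rw [h, Finset.map_refl]
    rw [hg (e.map _), this]

/-- `R[A]`: the hyperedges contained in `A`. -/
def edgesIn (M : Hypergraph r V) (A : Set V) : Set (Finset V) :=
  {e | e ∈ M.edges ∧ (e : Set V) ⊆ A}

/-- `A` and `C` are freely amalgamated (over `A ∩ C`): the only relations on `A ∪ C` are those on
`A` and those on `C`. -/
def FreelyAmalgamated (M : Hypergraph r V) (A C : Set V) : Prop :=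
  M.edgesIn (A ∪ C) = M.edgesIn A ∪ M.edgesIn C

/-! ### Predimension, self-sufficient subsets, the generic structure -/

/-- The predimension `δ(A) = n|A| - m|R[A]|` of a finite set `A`. It is only used for finite `A`. -/
noncomputable def predim (n m : ℕ) (M : Hypergraph r V) (A : Set V) : ℤ :=
  (n : ℤ) * (A.ncard : ℤ) - (m : ℤ) * ((M.edgesIn A).ncard : ℤ)

/-- `A ≤ B` for finite `B`: `A ⊆ B` and `δ(A) ≤ δ(B')` for all `A ⊆ B' ⊆ B`. -/
def FinLE (n m : ℕ) (M : Hypergraph r V) (A B : Set V) : Prop :=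
  A ⊆ B ∧ ∀ B' : Set V, A ⊆ B' → B' ⊆ B → M.predim n m A ≤ M.predim n m B'

/-- All finite substructures `X` of `M` satisfy `∅ ≤ X`. For a finite structure this is
membership in the class `C₀`. -/
def InC0 (n m : ℕ) (M : Hypergraph r V) : Prop :=
  ∀ X : Set V, X.Finite → M.FinLE n m ∅ X

/-- `A ≤ M` for an arbitrary subset `A` of `M`: `X ∩ A ≤ X` for all finite subsets `X` of `M`. -/
def SelfSufficient (n m : ℕ) (M : Hypergraph r V) (A : Set V) : Prop :=
  ∀ X : Set V, X.Finite → M.FinLE n m (X ∩ A) X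

/-- `M` is a generic structure for the class of finite `r`-uniform hypergraphs in `C₀` with `≤`. -/
structure IsGeneric (n m : ℕ) (M : Hypergraph r V) : Prop where
  countable : Countable V
  inC0 : M.InC0 n m
  /-- `M` is a union of a chain of finite self-sufficient substructures. -/
  chain : ∃ F : ℕ → Set V, Monotone F ∧ (∀ i, (F i).Finite ∧ M.SelfSufficient n m (F i)) ∧
    ⋃ i, F i = Set.univ
  /-- If `X ≤ M` is finite and `X ≤ A ∈ C₀` (the inclusion of `X` in `A` being the embedding `f`),
  then there is an embedding `α` of `A` in `M` over `X` with `α(A) ≤ M`. -/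
  extension : ∀ X : Set V, X.Finite → M.SelfSufficient n m X →
    ∀ (W : Type) [Finite W] (A : Hypergraph r W), A.InC0 n m →
    ∀ f : X ↪ W, (M.induce X).IsEmb A f → A.SelfSufficient n m (Set.range f) →
    ∃ α : W ↪ V, A.IsEmb M α ∧ (∀ x : X, α (f x) = x) ∧ M.SelfSufficient n m (Set.range α)

/-- `cl₀(X)`, the smallest self-sufficient subset of `M` which contains `X`. -/
def cl0 (n m : ℕ) (M : Hypergraph r V) (X : Set V) : Set V :=
  ⋂₀ {Y | X ⊆ Y ∧ M.SelfSufficient n m Y}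

/-- The dimension `d(X) = δ(cl₀(X))` of a finite set `X`. -/
noncomputable def dim (n m : ℕ) (M : Hypergraph r V) (X : Finset V) : ℤ :=
  M.predim n m (M.cl0 n m X)

/-! The next lemmas check that `cl₀(X)` is what it should be: it is the smallest self-sufficient
set containing `X`, and it is finite if `X` is, so that `dim` is well defined. -/

theorem edgesIn_finite (M : Hypergraph r V) {A : Set V} (hA : A.Finite) :
    (M.edgesIn A).Finite := by
  refine (hA.finite_subsets.preimage (f := fun e : Finset V => (e : Set V))
    (Finset.coe_injective.injOn)).subset ?_
  intro e he
  exact he.2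

theorem predim_submodular (n m : ℕ) (M : Hypergraph r V) {A B : Set V}
    (hA : A.Finite) (hB : B.Finite) :
    M.predim n m (A ∪ B) + M.predim n m (A ∩ B) ≤ M.predim n m A + M.predim n m B := by
  have h1 := Set.ncard_union_add_ncard_inter A B hA hB
  have h2 := Set.ncard_union_add_ncard_inter (M.edgesIn A) (M.edgesIn B)
    (M.edgesIn_finite hA) (M.edgesIn_finite hB)
  have h3 : M.edgesIn A ∩ M.edgesIn B = M.edgesIn (A ∩ B) := by
    ext e
    constructor
    · intro he
      exact ⟨he.1.1, Set.subset_inter he.1.2 he.2.2⟩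
    · intro he
      exact ⟨⟨he.1, he.2.trans Set.inter_subset_left⟩, ⟨he.1, he.2.trans Set.inter_subset_right⟩⟩
  have h4 : (M.edgesIn A ∪ M.edgesIn B).ncard ≤ (M.edgesIn (A ∪ B)).ncard := by
    refine Set.ncard_le_ncard ?_ (M.edgesIn_finite (hA.union hB))
    rintro e (he | he)
    · exact ⟨he.1, he.2.trans Set.subset_union_left⟩
    · exact ⟨he.1, he.2.trans Set.subset_union_right⟩
  rw [h3] at h2
  have h5 : ((A ∪ B).ncard : ℤ) + (A ∩ B).ncard = A.ncard + B.ncard := by exact_mod_cast h1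
  have h6 : ((M.edgesIn A).ncard : ℤ) + (M.edgesIn B).ncard ≤
      (M.edgesIn (A ∪ B)).ncard + (M.edgesIn (A ∩ B)).ncard := by
    have : (M.edgesIn A).ncard + (M.edgesIn B).ncard ≤
      (M.edgesIn (A ∪ B)).ncard + (M.edgesIn (A ∩ B)).ncard := by omega
    exact_mod_cast this
  have h7 := mul_le_mul_of_nonneg_left h6 (Int.natCast_nonneg m)
  have h8 := congrArg (fun t : ℤ => (n : ℤ) * t) h5
  simp only [predim]
  simp only [mul_add] at h7 h8
  linarith

/-- Self-sufficient sets are closed under finite, hence under arbitrary intersections. -/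
theorem SelfSufficient.inter {n m : ℕ} {M : Hypergraph r V} {A B : Set V}
    (hA : M.SelfSufficient n m A) (hB : M.SelfSufficient n m B) :
    M.SelfSufficient n m (A ∩ B) := by
  intro X hX
  refine ⟨Set.inter_subset_left, fun B' h1 h2 => ?_⟩
  have hB' : B'.Finite := hX.subset h2
  have e1 : X ∩ (A ∩ B) = (B' ∩ A) ∩ B := by
    ext x
    constructor
    · intro hx
      exact ⟨⟨h1 hx, hx.2.1⟩, hx.2.2⟩
    · intro hx
      exact ⟨h2 hx.1.1, hx.1.2, hx.2⟩
  rw [e1]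
  exact ((hB (B' ∩ A) (hB'.subset Set.inter_subset_left)).2 _ Set.inter_subset_left le_rfl).trans
    ((hA B' hB').2 B' Set.inter_subset_left le_rfl)

theorem exists_finite_selfSufficient {n m : ℕ} {M : Hypergraph r V} (hM : M.InC0 n m)
    {X : Set V} (hX : X.Finite) :
    ∃ Y : Set V, X ⊆ Y ∧ Y.Finite ∧ M.SelfSufficient n m Y := by
  have hnn : ∀ Y : Set V, Y.Finite → M.predim n m ∅ ≤ M.predim n m Y := fun Y hY =>
    (hM Y hY).2 Y (Set.empty_subset _) le_rfl
  let S : Set (Set V) := {Y | X ⊆ Y ∧ Y.Finite}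
  have hS : S.Nonempty := ⟨X, le_rfl, hX⟩
  obtain ⟨Y, hY, hmin⟩ := exists_minimalFor_of_wellFoundedLT (fun Y => Y ∈ S)
    (fun Y => (M.predim n m Y - M.predim n m ∅).toNat) hS
  refine ⟨Y, hY.1, hY.2, fun Z hZ => ⟨Set.inter_subset_left, fun B h1 h2 => ?_⟩⟩
  have hB : B.Finite := hZ.subset h2
  have h3 : Y ∩ B = Z ∩ Y := by
    ext x
    exact ⟨fun hx => ⟨h2 hx.2, hx.1⟩, fun hx => ⟨hx.2, h1 hx⟩⟩
  have h4 := M.predim_submodular n m hY.2 hB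
  have h5 : M.predim n m Y ≤ M.predim n m (Y ∪ B) := by
    have hU : Y ∪ B ∈ S := ⟨hY.1.trans Set.subset_union_left, hY.2.union hB⟩
    by_contra hlt
    push Not at hlt
    have a1 := hnn Y hY.2
    have a2 := hnn _ hU.2
    have a3 := hmin hU (by simp only; omega)
    simp only at a3
    omega
  rw [h3] at h4
  linarith

/-- If all finite substructures of `M` are in `C₀` and `X` is finite, then `cl₀(X)` is a finite
self-sufficient set; by definition it contains `X` and lies in every self-sufficient set that
contains `X`. -/
theorem cl0_spec {n m : ℕ} {M : Hypergraph r V} (hM : M.InC0 n m)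
    {X : Set V} (hX : X.Finite) :
    (M.cl0 n m X).Finite ∧ M.SelfSufficient n m (M.cl0 n m X) ∧ X ⊆ M.cl0 n m X := by
  obtain ⟨Y₀, h0, hf0, hs0⟩ := exists_finite_selfSufficient hM hX
  let S : Set (Set V) := {Y | (X ⊆ Y ∧ M.SelfSufficient n m Y) ∧ Y.Finite}
  obtain ⟨Y, ⟨⟨hXY, hs⟩, hf⟩, hmin⟩ := exists_minimalFor_of_wellFoundedLT (fun Y => Y ∈ S)
    Set.ncard ⟨Y₀, ⟨h0, hs0⟩, hf0⟩
  have key : M.cl0 n m X = Y := by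
    apply Set.Subset.antisymm
    · exact Set.sInter_subset_of_mem ⟨hXY, hs⟩
    · refine Set.subset_sInter fun Z hZ => ?_
      have h1 : Y ∩ Z ∈ S := ⟨⟨Set.subset_inter hXY hZ.1, hs.inter hZ.2⟩,
        hf.subset Set.inter_subset_left⟩
      have h2 := hmin h1 (Set.ncard_le_ncard Set.inter_subset_left hf)
      have h3 := Set.eq_of_subset_of_ncard_le (Set.inter_subset_left : Y ∩ Z ⊆ Y) h2 hf
      exact Set.inter_eq_left.1 h3
  rw [key]
  exact ⟨hf, hs, hXY⟩

end Hypergraph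

/-! ### Dimension functions, with respect to a group `G` of permutations of `V`

In the applications `V` is a structure and `G` is its automorphism group. -/

section DimensionFunctions

open Classical in
/-- `d` is an integer-valued dimension function on the finite subsets of `V`, normalized by
`d(∅) = 0`. -/
structure IsDimensionFunction (G : Subgroup (Equiv.Perm V)) (d : Finset V → ℤ) : Prop where
  invariant : ∀ g ∈ G, ∀ X : Finset V, d (X.map g.toEmbedding) = d X
  nonneg : ∀ X : Finset V, 0 ≤ d X
  mono : ∀ X Y : Finset V, d X ≤ d (X ∪ Y)
  submodular : ∀ X Y : Finset V, d (X ∪ Y) ≤ d X + d Y - d (X ∩ Y)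
  empty : d ∅ = 0

open Classical in
/-- `d(X/Z)` for a finite set `X` and an arbitrary set `Z`: the minimum of
`d(X/Y) = d(X ∪ Y) - d(Y)` over the finite subsets `Y` of `Z`. (For a dimension function these are
non-negative integers, so the infimum is a minimum.) -/
noncomputable def relDim (d : Finset V → ℤ) (X : Finset V) (Z : Set V) : ℤ :=
  ⨅ Y : {Y : Finset V // (Y : Set V) ⊆ Z}, (d (X ∪ Y.1) - d Y.1)

/-- `d(A/Z)` for arbitrary sets `A` and `Z`: the maximum of `d(X/Z)` over the finite subsets `X`
of `A`. It is used for `A` contained in the `d`-closure of a finite set `X₀`; then `d(X/Z)` is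
bounded by `d(X₀)`, so the supremum is a maximum. -/
noncomputable def setDim (d : Finset V → ℤ) (A Z : Set V) : ℤ :=
  ⨆ X : {X : Finset V // (X : Set V) ⊆ A}, relDim d X.1 Z

/-- The `d`-closure `cl^d(Z)`. -/
def dcl (d : Finset V → ℤ) (Z : Set V) : Set V :=
  {a | relDim d {a} Z = 0}

/-- The set `𝒳` of `d`-closures of finite sets. -/
def dClosures (d : Finset V → ℤ) : Set (Set V) :=
  {A | ∃ X : Finset V, A = dcl d X}

/-- `d`-independence of `A` and `C` over `B`. -/
def DIndep (d : Finset V → ℤ) (A B C : Set V) : Prop :=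
  setDim d A (B ∪ C) = setDim d A B

/-- `g` fixes every element of `B`. -/
def FixesPointwise (g : Equiv.Perm V) (B : Set V) : Prop :=
  ∀ b ∈ B, g b = b

/-- `cl^d` subsumes definable closure: if `X` is finite and `a` is fixed by all elements of `G`
which fix `cl^d(X)` pointwise, then `a ∈ cl^d(X)`. -/
def SubsumesDefinableClosure (G : Subgroup (Equiv.Perm V)) (d : Finset V → ℤ) : Prop :=
  ∀ (X : Finset V) (a : V), (∀ g ∈ G, FixesPointwise g (dcl d X) → g a = a) → a ∈ dcl d X

/-- Existence for `d`-independence. -/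
def Existence (G : Subgroup (Equiv.Perm V)) (d : Finset V → ℤ) : Prop :=
  ∀ A ∈ dClosures d, ∀ B ∈ dClosures d, ∀ C ∈ dClosures d,
    ∃ g ∈ G, FixesPointwise g B ∧ DIndep d (g '' A) B C

/-- `h` is a partial automorphism: a bijection between elements of `𝒳` which extends to an element
of `G`. -/
def IsPartialAut (G : Subgroup (Equiv.Perm V)) (d : Finset V → ℤ) {A B : Set V} (h : A ≃ B) :
    Prop :=
  A ∈ dClosures d ∧ B ∈ dClosures d ∧ ∃ g ∈ G, ∀ a : A, g a = h a

/-- Stationarity of `d`-independence: if `h : A₁ → A₂` is a partial automorphism which is the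
identity on `B`, and both `Aᵢ ⊇ B` are independent from `C` over `B`, then some partial automorphism
`k` contains `h ∪ id_C`. -/
def StationaryIndep (G : Subgroup (Equiv.Perm V)) (d : Finset V → ℤ) : Prop :=
  ∀ A₁ ∈ dClosures d, ∀ A₂ ∈ dClosures d, ∀ B ∈ dClosures d, ∀ C ∈ dClosures d,
    B ⊆ A₁ → B ⊆ A₂ → DIndep d A₁ B C → DIndep d A₂ B C →
    ∀ h : A₁ ≃ A₂, (∀ a : A₁, (a : V) ∈ B → (h a : V) = a) → IsPartialAut G d h →
    ∃ (D E : Set V) (k : D ≃ E), IsPartialAut G d k ∧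
      (∀ a : A₁, ∃ ha : (a : V) ∈ D, (k ⟨a, ha⟩ : V) = h a) ∧
      (∀ c ∈ C, ∃ hc : c ∈ D, (k ⟨c, hc⟩ : V) = c)

end DimensionFunctions

end Hrushovski

open Hrushovski

/-! # The generic hypergraph: extending isomorphisms of `d`-closed sets -/

/-! By `setRank_le_predim`, d(X) is the least δ(Z) over finite Z ⊇ X, so d inherits monotonicity and
submodularity from δ. The defect in the submodularity of δ at A, B is m times the number of edges
inside A ∪ B that lie in neither set. Equality therefore forces free amalgamation, and every
freeness statement below is obtained from such a numerical equality.

Homogeneity, both forms of stationarity and Existence rest on one extension theorem,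
`IsAmalgamIso.exists_mem_aut`: let P and Q be self-sufficient free unions of two self-sufficient
sets, each finite or d-closed, with P and Q inside d-closures of finite sets; then an isomorphism h
: P → Q respecting the two pieces extends to an automorphism. It is proved by back and forth through
finite maps f compatible with h whose domain and range are free over P and Q. Such an f is extended
to a finite self-sufficient D by gluing it to h on D ∩ P and applying genericity. Two things could
go wrong. Freeness over the infinite set P could be lost, but it is automatic once D ∩ P spans P
(`freeOver_of_subset_dcl`). The image of D could also meet Q outside h(D ∩ P). For d-closed P a
comparison of predimensions excludes this, since points added to D ∩ P without raising δ stay in P.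
A union of two d-closed sets need not be d-closed, so `IsAmalgamIso.exists_control` compares the two
pieces separately.

Homogeneity is the case where one piece is empty, and d-stationarity is the case h ∪ id on A₁ ∪ C.
For independence over B, a set C that need not contain B is replaced by cl^d(B ∪ C); independent
sets are then freely amalgamated (`selfSufficient_union_and_free_of_setDim_eq`), and the same
argument applies. For Existence, a finite self-sufficient Z containing sets spanning A, B and C is
doubled freely over Z ∩ B. The double embeds in M over Z, and the map from Z to its copy, together
with the identity on B, extends to the required automorphism. Existence implies that cl^d subsumes
definable closure: apply it to cl^d(Xa) against itself, over cl^d(X). -/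

namespace Hrushovski
universe u v w

namespace Hypergraph

/-! ### Embeddings defined on a subset -/

variable {r : ℕ} {V : Type u} {W : Type v} {U : Type w} {n m : ℕ}

open scoped Classical in
/-- `f` restricts to an embedding of the substructure on `S`. -/
def IsEmbOn (M : Hypergraph r V) (N : Hypergraph r W) (f : V → W) (S : Set V) : Prop :=
  Set.InjOn f S ∧ ∀ e : Finset V, (e : Set V) ⊆ S → (e ∈ M.edges ↔ e.image f ∈ N.edges)

open scoped Classical in
theorem exists_finset_image_eq {f : V → W} {X : Set V} {e : Finset W} (he : (e : Set W) ⊆ f '' X) :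
    ∃ e' : Finset V, (e' : Set V) ⊆ X ∧ e'.image f = e := by
  obtain ⟨e', h1, h2⟩ := Finset.subset_set_image_iff.1 he
  exact ⟨e', h1, h2⟩

theorem isEmbOn_of_coe_eq {M : Hypergraph r V} {N : Hypergraph r W} {f : V → W} {S : Set V}
    (hf : Set.InjOn f S) (h : ∀ (e : Finset V) (e' : Finset W), (e : Set V) ⊆ S →
      (e' : Set W) = f '' e → (e ∈ M.edges ↔ e' ∈ N.edges)) : M.IsEmbOn N f S := by
  classical exact ⟨hf, fun e he => h e _ he Finset.coe_image⟩

namespace IsEmbOn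

variable {M : Hypergraph r V} {N : Hypergraph r W} {O : Hypergraph r U} {f : V → W} {S : Set V}

theorem mono (h : M.IsEmbOn N f S) {T : Set V} (hT : T ⊆ S) : M.IsEmbOn N f T :=
  ⟨h.1.mono hT, fun e he => h.2 e (he.trans hT)⟩

theorem congr (h : M.IsEmbOn N f S) {g : V → W} (hg : Set.EqOn g f S) : M.IsEmbOn N g S := by
  classical
  refine ⟨h.1.congr hg.symm, fun e he => ?_⟩
  rw [h.2 e he, Finset.image_congr (fun x hx => hg (he hx))]

theorem comp {g : W → U} (hg : N.IsEmbOn O g (f '' S)) (h : M.IsEmbOn N f S) :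
    M.IsEmbOn O (g ∘ f) S := by
  classical
  refine ⟨hg.1.comp h.1 (Set.mapsTo_image f S), fun e he => ?_⟩
  rw [h.2 e he, hg.2, Finset.image_image]
  rw [Finset.coe_image]
  exact Set.image_mono he

theorem leftInverse (h : M.IsEmbOn N f S) {g : W → V} (hg : ∀ x ∈ S, g (f x) = x) :
    N.IsEmbOn M g (f '' S) := by
  classical
  refine ⟨?_, fun e he => ?_⟩
  · rintro _ ⟨x, hx, rfl⟩ _ ⟨y, hy, rfl⟩ hxy
    rw [hg x hx, hg y hy] at hxy
    rw [hxy]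
  · obtain ⟨e', h1, rfl⟩ := exists_finset_image_eq he
    rw [← h.2 e' h1, Finset.image_image]
    have : e'.image (g ∘ f) = e' := by
      conv_rhs => rw [← Finset.image_id (s := e')]
      exact Finset.image_congr fun x hx => hg x (h1 hx)
    rw [this]

theorem edgesIn_image (h : M.IsEmbOn N f S) {X : Set V} (hX : X ⊆ S) :
    open scoped Classical in N.edgesIn (f '' X) = Finset.image f '' M.edgesIn X := by
  classical
  ext e
  constructor
  · rintro ⟨he, hs⟩
    obtain ⟨e', h1, rfl⟩ := exists_finset_image_eq hs
    exact ⟨e', ⟨(h.2 e' (h1.trans hX)).2 he, h1⟩, by simp⟩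
  · rintro ⟨e', ⟨he, hs⟩, rfl⟩
    refine ⟨?_, ?_⟩
    · simpa using (h.2 e' (hs.trans hX)).1 he
    · rw [Finset.coe_image]
      exact Set.image_mono hs

theorem predim_image (h : M.IsEmbOn N f S) {X : Set V} (hX : X ⊆ S) :
    N.predim n m (f '' X) = M.predim n m X := by
  classical
  unfold predim
  rw [(h.1.mono hX).ncard_image, h.edgesIn_image hX, Set.InjOn.ncard_image]
  intro e he e' he' hee
  have h1 : f '' (e : Set V) = f '' (e' : Set V) := by
    rw [← Finset.coe_image, ← Finset.coe_image]
    exact congrArg _ hee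
  exact Finset.coe_injective
    ((h.1.image_eq_image_iff (he.2.trans hX) (he'.2.trans hX)).1 h1)

end IsEmbOn

theorem isEmbOn_id (M : Hypergraph r V) (S : Set V) : M.IsEmbOn M id S := by
  classical
  exact ⟨Set.injOn_id S, fun e _ => by rw [Finset.image_id]⟩

theorem IsEmb.isEmbOn {M : Hypergraph r V} {N : Hypergraph r W} {f : V ↪ W} (h : M.IsEmb N f)
    (S : Set V) : M.IsEmbOn N f S := by
  classical
  exact ⟨f.injective.injOn, fun e _ => by rw [h e, Finset.map_eq_image]⟩

theorem isEmbOn_subtype_val (M : Hypergraph r V) (A : Set V) (S : Set A) :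
    (M.induce A).IsEmbOn M Subtype.val S := by
  classical
  refine ⟨Subtype.val_injective.injOn, fun e _ => ?_⟩
  change e.map (Function.Embedding.subtype _) ∈ M.edges ↔ _
  rw [Finset.map_eq_image]
  rfl

theorem isEmbOn_of_mem_aut {M : Hypergraph r V} {g : Equiv.Perm V} (hg : g ∈ M.aut) (S : Set V) :
    M.IsEmbOn M g S :=
  IsEmb.isEmbOn (f := g.toEmbedding) hg S

theorem mem_aut_of_isEmbOn {M : Hypergraph r V} {g : Equiv.Perm V}
    (hg : M.IsEmbOn M g Set.univ) : g ∈ M.aut := by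
  classical
  intro e
  rw [Finset.map_eq_image]
  exact hg.2 e (Set.subset_univ _)

/-! ### Free amalgamation and the predimension -/

theorem freelyAmalgamated_iff {M : Hypergraph r V} {A C : Set V} :
    M.FreelyAmalgamated A C ↔
      ∀ e ∈ M.edges, (e : Set V) ⊆ A ∪ C → (e : Set V) ⊆ A ∨ (e : Set V) ⊆ C := by
  constructor
  · intro h e he hs
    have : e ∈ M.edgesIn A ∪ M.edgesIn C := by
      rw [← h]
      exact ⟨he, hs⟩
    exact this.imp And.right And.right
  · intro h
    ext e
    constructor
    · rintro ⟨he, hs⟩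
      exact (h e he hs).imp (fun h => ⟨he, h⟩) (fun h => ⟨he, h⟩)
    · rintro (⟨he, hs⟩ | ⟨he, hs⟩)
      · exact ⟨he, hs.trans Set.subset_union_left⟩
      · exact ⟨he, hs.trans Set.subset_union_right⟩

theorem FreelyAmalgamated.inter {M : Hypergraph r V} {A C : Set V}
    (h : M.FreelyAmalgamated A C) (Z : Set V) : M.FreelyAmalgamated (Z ∩ A) (Z ∩ C) := by
  rw [freelyAmalgamated_iff] at *
  intro e he hs
  rw [← Set.inter_union_distrib_left] at hs
  exact (h e he (hs.trans Set.inter_subset_right)).imp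
    (Set.subset_inter (hs.trans Set.inter_subset_left))
    (Set.subset_inter (hs.trans Set.inter_subset_left))

/-- This is inclusion–exclusion for vertices and edges with the error term kept: the crossing edges
are the only obstruction to modularity of δ. -/
theorem predim_union_add_inter (M : Hypergraph r V) {A B : Set V} (hA : A.Finite) (hB : B.Finite) :
    M.predim n m (A ∪ B) + M.predim n m (A ∩ B) +
      m * (((M.edgesIn (A ∪ B)) \ (M.edgesIn A ∪ M.edgesIn B)).ncard : ℤ) =
    M.predim n m A + M.predim n m B := by
  have h1 := Set.ncard_union_add_ncard_inter A B hA hB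
  have h2 := Set.ncard_union_add_ncard_inter (M.edgesIn A) (M.edgesIn B)
    (M.edgesIn_finite hA) (M.edgesIn_finite hB)
  have h3 : M.edgesIn A ∩ M.edgesIn B = M.edgesIn (A ∩ B) := by
    ext e
    constructor
    · intro he
      exact ⟨he.1.1, Set.subset_inter he.1.2 he.2.2⟩
    · intro he
      exact ⟨⟨he.1, he.2.trans Set.inter_subset_left⟩, ⟨he.1, he.2.trans Set.inter_subset_right⟩⟩
  have h4 : M.edgesIn A ∪ M.edgesIn B ⊆ M.edgesIn (A ∪ B) := by
    rintro e (he | he)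
    · exact ⟨he.1, he.2.trans Set.subset_union_left⟩
    · exact ⟨he.1, he.2.trans Set.subset_union_right⟩
  have h5 := Set.ncard_sdiff_add_ncard_of_subset h4 (M.edgesIn_finite (hA.union hB))
  rw [h3] at h2
  unfold predim
  zify at h1 h2 h5
  linear_combination (n : ℤ) * h1 - (m : ℤ) * h2 + (m : ℤ) * h5

theorem FreelyAmalgamated.predim_union_add_inter {M : Hypergraph r V} {A B : Set V}
    (h : M.FreelyAmalgamated A B) (hA : A.Finite) (hB : B.Finite) :
    M.predim n m (A ∪ B) + M.predim n m (A ∩ B) = M.predim n m A + M.predim n m B := by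
  have h1 := M.predim_union_add_inter (n := n) (m := m) hA hB
  rw [show M.edgesIn (A ∪ B) = M.edgesIn A ∪ M.edgesIn B from h] at h1
  simpa using h1

/-- Each crossing edge costs m ≥ 1, so reversing the submodular inequality leaves room for none. -/
theorem freelyAmalgamated_of_predim_le (hm : 1 ≤ m) {M : Hypergraph r V} {A B : Set V}
    (hA : A.Finite) (hB : B.Finite)
    (h : M.predim n m A + M.predim n m B ≤ M.predim n m (A ∪ B) + M.predim n m (A ∩ B)) :
    M.FreelyAmalgamated A B := by
  have h1 := M.predim_union_add_inter (n := n) (m := m) hA hB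
  have hm' : (1 : ℤ) ≤ m := by exact_mod_cast hm
  have h2 : ((M.edgesIn (A ∪ B)) \ (M.edgesIn A ∪ M.edgesIn B)).ncard = 0 := by
    by_contra h3
    have h4 : (1 : ℤ) ≤ ((M.edgesIn (A ∪ B)) \ (M.edgesIn A ∪ M.edgesIn B)).ncard := by
      exact_mod_cast Nat.one_le_iff_ne_zero.2 h3
    nlinarith
  rw [Set.ncard_eq_zero ((M.edgesIn_finite (hA.union hB)).subset Set.sdiff_subset)] at h2
  rw [freelyAmalgamated_iff]
  intro e he hs
  by_contra hne
  have : e ∈ (M.edgesIn (A ∪ B)) \ (M.edgesIn A ∪ M.edgesIn B) :=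
    ⟨⟨he, hs⟩, fun hu => hne (hu.imp And.right And.right)⟩
  rw [h2] at this
  exact this

theorem predim_empty (hr : 1 ≤ r) (M : Hypergraph r V) : M.predim n m ∅ = 0 := by
  have : M.edgesIn ∅ = ∅ := by
    ext e
    simp only [Set.mem_empty_iff_false, iff_false]
    rintro ⟨he, hs⟩
    have h1 := M.card_edge e he
    have h2 : e = ∅ := by
      rw [← Finset.coe_eq_empty]
      exact Set.subset_empty_iff.1 hs
    rw [h2, Finset.card_empty] at h1
    omega
  simp [predim, this]

/-! ### Self-sufficient sets -/

section

variable {M : Hypergraph r V}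

theorem SelfSufficient.predim_inter_le {A : Set V} (hA : M.SelfSufficient n m A) {Z : Set V}
    (hZ : Z.Finite) : M.predim n m (Z ∩ A) ≤ M.predim n m Z :=
  (hA Z hZ).2 Z Set.inter_subset_left le_rfl

theorem selfSufficient_of_predim_inter_le {A : Set V}
    (h : ∀ Z : Set V, Z.Finite → M.predim n m (Z ∩ A) ≤ M.predim n m Z) :
    M.SelfSufficient n m A := by
  refine fun X hX => ⟨Set.inter_subset_left, fun B h1 h2 => ?_⟩
  have : X ∩ A = B ∩ A :=
    Set.Subset.antisymm (Set.subset_inter h1 Set.inter_subset_right)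
      (Set.inter_subset_inter_left _ h2)
  rw [this]
  exact h B (hX.subset h2)

theorem SelfSufficient.predim_le {A : Set V} (hA : M.SelfSufficient n m A) {Z : Set V}
    (hZ : Z.Finite) (hAZ : A ⊆ Z) : M.predim n m A ≤ M.predim n m Z := by
  have := hA.predim_inter_le hZ
  rwa [Set.inter_eq_right.2 hAZ] at this

theorem selfSufficient_of_predim_le {A : Set V} (hA : A.Finite)
    (h : ∀ Z : Set V, Z.Finite → A ⊆ Z → M.predim n m A ≤ M.predim n m Z) :
    M.SelfSufficient n m A := by
  refine selfSufficient_of_predim_inter_le fun Z hZ => ?_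
  have h1 := M.predim_submodular n m hZ hA
  have h2 := h (Z ∪ A) (hZ.union hA) Set.subset_union_right
  linarith

theorem selfSufficient_empty (hM : M.InC0 n m) : M.SelfSufficient n m ∅ :=
  selfSufficient_of_predim_le Set.finite_empty fun Z hZ _ =>
    (hM Z hZ).2 Z (Set.empty_subset _) le_rfl

/-- The dimension of a finite set, as a function on sets. -/
noncomputable def setRank (n m : ℕ) (M : Hypergraph r V) (X : Set V) : ℤ :=
  M.predim n m (M.cl0 n m X)

theorem dim_eq_setRank (X : Finset V) : M.dim n m X = M.setRank n m X := rfl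

theorem subset_cl0 (X : Set V) : X ⊆ M.cl0 n m X :=
  Set.subset_sInter fun _ h => h.1

theorem cl0_subset {X Y : Set V} (h : X ⊆ Y) (hY : M.SelfSufficient n m Y) : M.cl0 n m X ⊆ Y :=
  Set.sInter_subset_of_mem ⟨h, hY⟩

theorem SelfSufficient.cl0_eq {X : Set V} (hX : M.SelfSufficient n m X) : M.cl0 n m X = X :=
  (cl0_subset le_rfl hX).antisymm (subset_cl0 X)

theorem SelfSufficient.setRank_eq {X : Set V} (hX : M.SelfSufficient n m X) :
    M.setRank n m X = M.predim n m X := by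
  rw [setRank, hX.cl0_eq]

variable (hM : M.InC0 n m)
include hM

/-- A finite superset of Z with least δ is self-sufficient, hence contains cl₀(X), and
self-sufficiency of cl₀(X) bounds δ(cl₀(X)) by that least value. Consequently d(X) is the minimum of
δ over finite supersets of X. -/
theorem setRank_le_predim {X Z : Set V} (hXZ : X ⊆ Z) (hZ : Z.Finite) :
    M.setRank n m X ≤ M.predim n m Z := by
  let S : Set (Set V) := {Y | Z ⊆ Y ∧ Y.Finite}
  obtain ⟨Y, hY, hmin⟩ := exists_minimalFor_of_wellFoundedLT (fun Y => Y ∈ S)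
    (fun Y => (M.predim n m Y - M.predim n m ∅).toNat) ⟨Z, le_rfl, hZ⟩
  have hmin' : ∀ Y' ∈ S, M.predim n m Y ≤ M.predim n m Y' := by
    intro Y' hY'
    by_contra hlt
    have a1 := (hM Y hY.2).2 Y (Set.empty_subset _) le_rfl
    have a2 := (hM Y' hY'.2).2 Y' (Set.empty_subset _) le_rfl
    have a3 := hmin hY' (by simp only; omega)
    simp only at a3
    omega
  have hs : M.SelfSufficient n m Y :=
    selfSufficient_of_predim_le hY.2 fun Y' h1 h2 => hmin' Y' ⟨hY.1.trans h2, h1⟩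
  exact ((cl0_spec hM (hZ.subset hXZ)).2.1.predim_le hY.2
    (cl0_subset (hXZ.trans hY.1) hs)).trans (hmin' Z ⟨le_rfl, hZ⟩)

theorem selfSufficient_of_predim_le_setRank {X : Set V} (hX : X.Finite)
    (h : M.predim n m X ≤ M.setRank n m X) : M.SelfSufficient n m X :=
  selfSufficient_of_predim_le hX fun _ hZ hXZ => h.trans (setRank_le_predim hM hXZ hZ)

theorem setRank_mono {X Y : Set V} (hXY : X ⊆ Y) (hY : Y.Finite) :
    M.setRank n m X ≤ M.setRank n m Y :=
  setRank_le_predim hM (hXY.trans (subset_cl0 Y)) (cl0_spec hM hY).1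

/-- The union and the intersection of the two closures are finite supersets of X ∪ Y and X ∩ Y, so
submodularity of δ at the closures suffices. -/
theorem setRank_submodular {X Y : Set V} (hX : X.Finite) (hY : Y.Finite) :
    M.setRank n m (X ∪ Y) + M.setRank n m (X ∩ Y) ≤ M.setRank n m X + M.setRank n m Y := by
  have hX' := (cl0_spec hM hX).1
  have hY' := (cl0_spec hM hY).1
  have h1 := M.predim_submodular n m hX' hY'
  have h2 := setRank_le_predim hM
    (Set.union_subset_union (subset_cl0 (n := n) (m := m) (M := M) X)
      (subset_cl0 (n := n) (m := m) (M := M) Y))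
    (hX'.union hY')
  have h3 := setRank_le_predim hM
    (Set.inter_subset_inter (subset_cl0 (n := n) (m := m) (M := M) X)
      (subset_cl0 (n := n) (m := m) (M := M) Y))
    (hX'.inter_of_left _)
  unfold setRank at *
  linarith

theorem setRank_image_le {g : Equiv.Perm V} (hg : g ∈ M.aut) {X : Set V} (hX : X.Finite) :
    M.setRank n m (g '' X) ≤ M.setRank n m X := by
  have h := (isEmbOn_of_mem_aut hg Set.univ).predim_image (n := n) (m := m)
    (Set.subset_univ (M.cl0 n m X))
  rw [setRank, setRank, ← h]
  exact setRank_le_predim hM (Set.image_mono (subset_cl0 X)) ((cl0_spec hM hX).1.image _)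

theorem isDimensionFunction_dim (hr : 1 ≤ r) : IsDimensionFunction M.aut (M.dim n m) where
  invariant g hg X := by
    rw [dim_eq_setRank, dim_eq_setRank, Finset.coe_map]
    refine (setRank_image_le hM hg X.finite_toSet).antisymm ?_
    have h := setRank_image_le hM (M.aut.inv_mem hg) (X.finite_toSet.image g)
    have e : ⇑g⁻¹ '' (⇑g '' (X : Set V)) = X := by
      rw [Set.image_image]
      simp
    rw [e] at h
    exact h
  nonneg X := by
    have h := setRank_mono hM (Set.empty_subset (X : Set V)) X.finite_toSet
    rwa [(selfSufficient_empty hM).setRank_eq, predim_empty hr] at h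
  mono X Y := setRank_mono hM (by simp) (Finset.finite_toSet _)
  submodular X Y := by
    have h := setRank_submodular hM X.finite_toSet Y.finite_toSet
    simp only [dim_eq_setRank, Finset.coe_union, Finset.coe_inter]
    linarith
  empty := by
    rw [dim_eq_setRank, Finset.coe_empty, (selfSufficient_empty hM).setRank_eq, predim_empty hr]

/-- A set which contains the closures of its finite subsets is self-sufficient. -/
theorem selfSufficient_of_cl0_subset {A : Set V}
    (h : ∀ X : Set V, X.Finite → X ⊆ A → M.cl0 n m X ⊆ A) : M.SelfSufficient n m A := by
  refine selfSufficient_of_predim_inter_le fun Z hZ => ?_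
  have hf := hZ.inter_of_left A
  obtain ⟨h1, h2, h3⟩ := cl0_spec hM hf
  -- Since cl₀(Z ∩ A) lies in A, inside Z it can replace A, and it is self-sufficient.
  have h4 : Z ∩ M.cl0 n m (Z ∩ A) = Z ∩ A :=
    (Set.inter_subset_inter_right Z (h _ hf Set.inter_subset_right)).antisymm
      (Set.subset_inter Set.inter_subset_left h3)
  rw [← h4]
  exact h2.predim_inter_le hZ

/-- An increasing union of free amalgams of finite self-sufficient sets. -/
theorem selfSufficient_union_and_freelyAmalgamated {A C : Set V}
    (h : ∀ S : Set V, S.Finite → S ⊆ A ∪ C → ∃ D E : Set V, D ⊆ A ∧ E ⊆ C ∧ S ⊆ D ∪ E ∧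
      M.SelfSufficient n m (D ∪ E) ∧ M.FreelyAmalgamated D E) :
    M.SelfSufficient n m (A ∪ C) ∧ M.FreelyAmalgamated A C := by
  constructor
  · refine selfSufficient_of_cl0_subset hM fun X hX hXA => ?_
    obtain ⟨D, E, hD, hE, hS, hs, -⟩ := h X hX hXA
    exact (cl0_subset hS hs).trans (Set.union_subset_union hD hE)
  · rw [freelyAmalgamated_iff]
    intro e he hs
    obtain ⟨D, E, hD, hE, hS, -, hf⟩ := h e e.finite_toSet hs
    exact (freelyAmalgamated_iff.1 hf e he hS).imp (fun h => h.trans hD) (fun h => h.trans hE)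

end

/-- If `f` embeds `S` onto a self-sufficient set, then it maps finite sets which are self-sufficient
in `S` to self-sufficient sets. -/
theorem IsEmbOn.selfSufficient_image_of_predim_le {M : Hypergraph r V} {N : Hypergraph r W}
    {f : W → V} {S : Set W} (hf : N.IsEmbOn M f S) (hS : M.SelfSufficient n m (f '' S))
    {E : Set W} (hE : E.Finite) (hES : E ⊆ S)
    (h : ∀ Z : Set W, Z.Finite → E ⊆ Z → Z ⊆ S → N.predim n m E ≤ N.predim n m Z) :
    M.SelfSufficient n m (f '' E) := by
  refine selfSufficient_of_predim_le (hE.image f) fun Z hZ hEZ => ?_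
  have h1 := hS.predim_inter_le hZ
  obtain ⟨Y, hY, hYZ⟩ := Set.subset_image_iff.1 (Set.inter_subset_right : Z ∩ f '' S ⊆ f '' S)
  have hYf : Y.Finite := by
    refine Set.Finite.of_finite_image (f := f) ?_ (hf.1.mono hY)
    rw [hYZ]
    exact hZ.inter_of_left _
  have hEY : E ⊆ Y := by
    intro x hx
    have h2 : f x ∈ f '' Y := by
      rw [hYZ]
      exact ⟨hEZ (Set.mem_image_of_mem f hx), Set.mem_image_of_mem f (hES hx)⟩
    exact (hf.1.mem_image_iff hY (hES hx)).1 h2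
  rw [← hYZ, hf.predim_image hY] at h1
  rw [hf.predim_image hES]
  exact (h Y hYf hEY hY).trans h1

theorem IsEmbOn.selfSufficient_image {M : Hypergraph r V} {N : Hypergraph r W}
    {f : W → V} {S : Set W} (hf : N.IsEmbOn M f S) (hS : M.SelfSufficient n m (f '' S))
    {E : Set W} (hE : E.Finite) (hES : E ⊆ S) (h : N.SelfSufficient n m E) :
    M.SelfSufficient n m (f '' E) :=
  hf.selfSufficient_image_of_predim_le hS hE hES fun _ hZ hEZ _ => h.predim_le hZ hEZ

open scoped Classical in
/-- Two embeddings which agree on the common part of their domains induce an embedding of the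
free amalgam. -/
theorem IsEmbOn.union {M : Hypergraph r V} {N : Hypergraph r W} {f h : V → W} {A C : Set V}
    (hf : M.IsEmbOn N f A) (hh : M.IsEmbOn N h C) (heq : Set.EqOn f h (A ∩ C))
    (hinter : ∀ x ∈ A, f x ∈ h '' C → x ∈ C)
    (hAC : M.FreelyAmalgamated A C) (hAC' : N.FreelyAmalgamated (f '' A) (h '' C)) :
    ∃ k : V → W, Set.EqOn k f A ∧ Set.EqOn k h C ∧ M.IsEmbOn N k (A ∪ C) := by
  have e1 : Set.EqOn (A.piecewise f h) f A := Set.piecewise_eqOn A f h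
  have e2 : Set.EqOn (A.piecewise f h) h C := by
    intro x hx
    by_cases hxA : x ∈ A
    · rw [e1 hxA]
      exact heq ⟨hxA, hx⟩
    · exact Set.piecewise_eq_of_notMem A f h hxA
  have i1 : A.piecewise f h '' A = f '' A := e1.image_eq
  have i2 : A.piecewise f h '' C = h '' C := e2.image_eq
  have hf' := hf.congr e1
  have hh' := hh.congr e2
  refine ⟨A.piecewise f h, e1, e2, ?_⟩
  generalize A.piecewise f h = k at *
  -- By `hinter`, images of A and C coincide only at points coming from A ∩ C, so injectivity on C
  -- is enough.
  have key : ∀ x ∈ A, ∀ y ∈ C, k x = k y → x = y := by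
    intro x hx y hy hxy
    have hxC : x ∈ C := hinter x hx ⟨y, hy, by rw [← e2 hy, ← hxy, e1 hx]⟩
    exact hh'.1 hxC hy hxy
  have hinj : Set.InjOn k (A ∪ C) := by
    rintro x (hx | hx) y (hy | hy) hxy
    · exact hf'.1 hx hy hxy
    · exact key x hx y hy hxy
    · exact (key y hy x hx hxy.symm).symm
    · exact hh'.1 hx hy hxy
  refine ⟨hinj, fun e he => ⟨fun hM => ?_, fun hN => ?_⟩⟩
  · rcases freelyAmalgamated_iff.1 hAC e hM he with h1 | h1
    · exact (hf'.2 e h1).1 hM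
    · exact (hh'.2 e h1).1 hM
  · have h2 : ((e.image k : Finset W) : Set W) ⊆ f '' A ∪ h '' C := by
      rw [Finset.coe_image, ← i1, ← i2, ← Set.image_union]
      exact Set.image_mono he
    have aux : ∀ X : Set V, X ⊆ A ∪ C → ((e.image k : Finset W) : Set W) ⊆ k '' X →
        (e : Set V) ⊆ X := by
      intro X hX hs x hx
      rw [Finset.coe_image] at hs
      exact (hinj.mem_image_iff hX (he hx)).1 (hs (Set.mem_image_of_mem k hx))
    rcases freelyAmalgamated_iff.1 hAC' _ hN h2 with h1 | h1
    · rw [← i1] at h1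
      exact (hf'.2 e (aux A Set.subset_union_left h1)).2 hN
    · rw [← i2] at h1
      exact (hh'.2 e (aux C Set.subset_union_right h1)).2 hN

end Hypergraph

/-! ### Closure and relative dimension for a dimension function -/

namespace IsDimensionFunction

variable {V : Type u} {G : Subgroup (Equiv.Perm V)} {d : Finset V → ℤ}

section

variable (hd : IsDimensionFunction G d)
include hd

theorem le_of_subset {X Y : Finset V} (h : X ⊆ Y) : d X ≤ d Y := by
  classical
  have := hd.mono X Y
  convert this using 2
  ext x
  simp only [Finset.mem_union]
  exact ⟨Or.inr, fun hx => hx.elim (fun h' => h h') id⟩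

open scoped Classical in
theorem union_add_le {X Y Z : Finset V} (hZ : Z ⊆ X ∩ Y) : d (X ∪ Y) + d Z ≤ d X + d Y := by
  have h1 := hd.submodular X Y
  have h2 := hd.le_of_subset hZ
  linarith

open scoped Classical in
theorem bddBelow (X : Finset V) (Z : Set V) :
    BddBelow (Set.range fun Y : {Y : Finset V // (Y : Set V) ⊆ Z} => d (X ∪ Y.1) - d Y.1) := by
  refine ⟨0, ?_⟩
  rintro _ ⟨Y, rfl⟩
  have := hd.le_of_subset (Finset.subset_union_right : Y.1 ⊆ X ∪ Y.1)
  simp only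
  linarith

open scoped Classical in
theorem relDim_le (X : Finset V) {Y : Finset V} {Z : Set V} (hY : (Y : Set V) ⊆ Z) :
    relDim d X Z ≤ d (X ∪ Y) - d Y :=
  ciInf_le (hd.bddBelow X Z) (⟨Y, hY⟩ : {Y : Finset V // (Y : Set V) ⊆ Z})

omit hd in
open scoped Classical in
theorem le_relDim {X : Finset V} {Z : Set V} {k : ℤ}
    (h : ∀ Y : Finset V, (Y : Set V) ⊆ Z → k ≤ d (X ∪ Y) - d Y) : k ≤ relDim d X Z := by
  have : Nonempty {Y : Finset V // (Y : Set V) ⊆ Z} := ⟨⟨∅, by simp⟩⟩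
  exact le_ciInf fun Y => h Y.1 Y.2

open scoped Classical in
theorem exists_relDim_eq (X : Finset V) (Z : Set V) :
    ∃ Y : Finset V, (Y : Set V) ⊆ Z ∧ relDim d X Z = d (X ∪ Y) - d Y := by
  have : Nonempty {Y : Finset V // (Y : Set V) ⊆ Z} := ⟨⟨∅, by simp⟩⟩
  obtain ⟨Y, hY⟩ := Int.csInf_mem (Set.range_nonempty _) (hd.bddBelow X Z)
  exact ⟨Y.1, Y.2, hY.symm⟩

theorem relDim_nonneg (X : Finset V) (Z : Set V) : 0 ≤ relDim d X Z := by
  classical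
  refine le_relDim fun Y _ => ?_
  have := hd.le_of_subset (Finset.subset_union_right : Y ⊆ X ∪ Y)
  linarith

theorem relDim_anti (X : Finset V) {Z Z' : Set V} (h : Z ⊆ Z') : relDim d X Z' ≤ relDim d X Z := by
  classical
  exact le_relDim fun Y hY => hd.relDim_le X (hY.trans h)

-- Diminishing returns: submodularity at X ∪ Y and Y', whose intersection contains Y.
open scoped Classical in
theorem sub_le_sub_of_subset (X : Finset V) {Y Y' : Finset V} (h : Y ⊆ Y') :
    d (X ∪ Y') - d Y' ≤ d (X ∪ Y) - d Y := by
  have h1 := hd.union_add_le (X := X ∪ Y) (Y := Y') (Z := Y)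
    (Finset.subset_inter Finset.subset_union_right h)
  rw [Finset.union_assoc, Finset.union_eq_right.2 h] at h1
  linarith

open scoped Classical in
theorem relDim_coe (X Z : Finset V) : relDim d X (Z : Set V) = d (X ∪ Z) - d Z :=
  (hd.relDim_le X le_rfl).antisymm
    (le_relDim fun _ hY => hd.sub_le_sub_of_subset X (Finset.coe_subset.1 hY))

open scoped Classical in
theorem exists_of_subset_dcl {X : Finset V} {Z : Set V} (h : (X : Set V) ⊆ dcl d Z) :
    ∃ Y : Finset V, (Y : Set V) ⊆ Z ∧ d (X ∪ Y) = d Y := by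
  induction X using Finset.induction_on with
  | empty => exact ⟨∅, by simp⟩
  | insert a X ha ih =>
    rw [Finset.coe_insert, Set.insert_subset_iff] at h
    obtain ⟨Y, hY, hXY⟩ := ih h.2
    obtain ⟨Y', hY', haY⟩ := hd.exists_relDim_eq {a} Z
    rw [show relDim d {a} Z = 0 from h.1] at haY
    refine ⟨Y ∪ Y', by simp [hY, hY'], ?_⟩
    have h1 := hd.sub_le_sub_of_subset X (Finset.subset_union_left : Y ⊆ Y ∪ Y')
    have h2 := hd.sub_le_sub_of_subset {a} (Y := Y') (Y' := X ∪ (Y ∪ Y'))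
      (Finset.subset_union_right.trans Finset.subset_union_right)
    have h3 : insert a X ∪ (Y ∪ Y') = {a} ∪ (X ∪ (Y ∪ Y')) := by
      rw [Finset.insert_eq, Finset.union_assoc]
    have h4 := hd.le_of_subset (Finset.subset_union_right : Y ∪ Y' ⊆ insert a X ∪ (Y ∪ Y'))
    rw [h3] at *
    linarith

open scoped Classical in
theorem mem_dcl_of_le {a : V} {Y : Finset V} {Z : Set V} (hY : (Y : Set V) ⊆ Z)
    (h : d ({a} ∪ Y) ≤ d Y) : a ∈ dcl d Z := by
  have h1 := hd.relDim_le {a} hY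
  have h2 := hd.relDim_nonneg {a} Z
  change relDim d {a} Z = 0
  linarith

theorem subset_dcl (Z : Set V) : Z ⊆ dcl d Z := by
  classical
  intro a ha
  refine hd.mem_dcl_of_le (Y := {a}) (by simpa using ha) ?_
  rw [Finset.union_idempotent]

theorem dcl_mono {Z Z' : Set V} (h : Z ⊆ Z') : dcl d Z ⊆ dcl d Z' := by
  intro a ha
  have h1 := hd.relDim_anti {a} h
  have h2 := hd.relDim_nonneg {a} Z'
  rw [show relDim d {a} Z = 0 from ha] at h1
  exact h1.antisymm h2

/-- A finite subset of the closure depends on a finite part of Z, so nothing is gained by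
conditioning on the closure. Idempotence of cl^d follows. -/
theorem relDim_dcl (X : Finset V) (Z : Set V) : relDim d X (dcl d Z) = relDim d X Z := by
  classical
  refine (hd.relDim_anti X (hd.subset_dcl Z)).antisymm (le_relDim fun Y hY => ?_)
  obtain ⟨Y', hY', h⟩ := hd.exists_of_subset_dcl hY
  have h1 := hd.relDim_le X hY'
  have h2 := hd.sub_le_sub_of_subset X (Finset.subset_union_left : Y ⊆ Y ∪ Y')
  have h3 := hd.le_of_subset
    (Finset.union_subset_union_right Finset.subset_union_right : X ∪ Y' ⊆ X ∪ (Y ∪ Y'))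
  linarith

theorem dcl_dcl (Z : Set V) : dcl d (dcl d Z) = dcl d Z := by
  ext a
  change relDim d {a} _ = 0 ↔ relDim d {a} _ = 0
  rw [hd.relDim_dcl]

theorem dcl_subset_dcl {Z Z' : Set V} (h : Z ⊆ dcl d Z') : dcl d Z ⊆ dcl d Z' := by
  have := hd.dcl_mono h
  rwa [hd.dcl_dcl] at this

open scoped Classical in
/-- A finite set in the closure of a finite set `Y` does not raise the dimension. -/
theorem union_eq_of_subset_dcl {X Y : Finset V} (h : (X : Set V) ⊆ dcl d Y) :
    d (X ∪ Y) = d Y := by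
  obtain ⟨Y', hY', h1⟩ := hd.exists_of_subset_dcl h
  have h2 := hd.sub_le_sub_of_subset X (Finset.coe_subset.1 hY')
  have h3 := hd.le_of_subset (Finset.subset_union_right : Y ⊆ X ∪ Y)
  linarith

/-- On finite subsets of B, d is bounded by d(X). A subset where d is largest spans B, because
adding a point of B cannot raise d further. -/
theorem exists_finset_basis {B : Set V} {X : Finset V} (hB : B ⊆ dcl d X) :
    ∃ Y : Finset V, (Y : Set V) ⊆ B ∧ B ⊆ dcl d Y := by
  classical
  obtain ⟨k, ⟨Y, hY, rfl⟩, hmax⟩ := Int.exists_greatest_of_bdd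
    (P := fun k => ∃ Y : Finset V, (Y : Set V) ⊆ B ∧ d Y = k)
    ⟨d X, by
      rintro _ ⟨Y, hY, rfl⟩
      rw [← hd.union_eq_of_subset_dcl (hY.trans hB)]
      exact hd.le_of_subset Finset.subset_union_left⟩ ⟨_, ∅, by simp, rfl⟩
  refine ⟨Y, hY, fun b hb => hd.mem_dcl_of_le le_rfl (hmax _ ⟨{b} ∪ Y, ?_, rfl⟩)⟩
  rw [Finset.coe_union, Finset.coe_singleton]
  exact Set.union_subset (Set.singleton_subset_iff.2 hb) hY

theorem dcl_eq_of_mem {A : Set V} (hA : A ∈ dClosures d) : dcl d A = A := by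
  obtain ⟨X, rfl⟩ := hA
  exact hd.dcl_dcl _

theorem exists_finset_of_mem {A : Set V} (hA : A ∈ dClosures d) :
    ∃ X : Finset V, (X : Set V) ⊆ A ∧ A ⊆ dcl d X := by
  obtain ⟨X, rfl⟩ := hA
  exact ⟨X, hd.subset_dcl _, le_rfl⟩

theorem dcl_union_mem {A B : Set V} (hA : A ∈ dClosures d) (hB : B ∈ dClosures d) :
    dcl d (A ∪ B) ∈ dClosures d := by
  classical
  obtain ⟨X, hX, hAX⟩ := hd.exists_finset_of_mem hA
  obtain ⟨Y, hY, hBY⟩ := hd.exists_finset_of_mem hB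
  refine ⟨X ∪ Y, Set.Subset.antisymm (hd.dcl_subset_dcl (Set.union_subset ?_ ?_))
    (hd.dcl_mono ?_)⟩
  · exact hAX.trans (hd.dcl_mono (by simp))
  · exact hBY.trans (hd.dcl_mono (by simp))
  · rw [Finset.coe_union]
    exact Set.union_subset_union hX hY

open scoped Classical in
theorem relDim_le_relDim_of_subset_dcl {X Y : Finset V} (h : (X : Set V) ⊆ dcl d Y) (Z : Set V) :
    relDim d X Z ≤ relDim d Y Z := by
  obtain ⟨Y', hY', h1⟩ := hd.exists_relDim_eq Y Z
  rw [h1]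
  have h2 := hd.relDim_le X hY'
  have h3 := hd.sub_le_sub_of_subset X (Finset.subset_union_left : Y ⊆ Y ∪ Y')
  have h4 := hd.union_eq_of_subset_dcl h
  have h5 := hd.le_of_subset
    (Finset.union_subset_union_right Finset.subset_union_right : X ∪ Y' ⊆ X ∪ (Y ∪ Y'))
  linarith

/-- The supremum is attained at any finite spanning subset, which turns independence into a
statement about finite sets. -/
theorem setDim_eq_relDim {A : Set V} {X : Finset V} (hX : (X : Set V) ⊆ A) (hA : A ⊆ dcl d X)
    (Z : Set V) : setDim d A Z = relDim d X Z := by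
  have : Nonempty {Y : Finset V // (Y : Set V) ⊆ A} := ⟨⟨X, hX⟩⟩
  have hle : ∀ Y : {Y : Finset V // (Y : Set V) ⊆ A}, relDim d Y.1 Z ≤ relDim d X Z :=
    fun Y => hd.relDim_le_relDim_of_subset_dcl (Y.2.trans hA) Z
  refine le_antisymm (ciSup_le hle) ?_
  exact le_ciSup (f := fun Y : {Y : Finset V // (Y : Set V) ⊆ A} => relDim d Y.1 Z)
    ⟨_, by rintro _ ⟨Y, rfl⟩; exact hle Y⟩ ⟨X, hX⟩

/-- Independent sets over `B` meet only in the closure of `B`. -/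
theorem mem_dcl_of_dIndep {A B C : Set V} {X : Finset V} (hX : (X : Set V) ⊆ A) (hA : A ⊆ dcl d X)
    (h : DIndep d A B C) {a : V} (haA : a ∈ A) (haC : a ∈ C) : a ∈ dcl d B := by
  classical
  have hX1 : ((({a} ∪ X : Finset V)) : Set V) ⊆ A := by
    rw [Finset.coe_union, Finset.coe_singleton]
    exact Set.union_subset (Set.singleton_subset_iff.2 haA) hX
  have hA1 : A ⊆ dcl d ({a} ∪ X : Finset V) := hA.trans (hd.dcl_mono (by simp))
  rw [DIndep, hd.setDim_eq_relDim hX1 hA1, hd.setDim_eq_relDim hX1 hA1] at h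
  obtain ⟨Y, hY, hY1⟩ := hd.exists_relDim_eq ({a} ∪ X) B
  refine hd.mem_dcl_of_le hY ?_
  -- With a in the spanning set and in C, independence gives d(aXY) − d(Y) ≤ d(aXY) − d(aY), hence
  -- d(aY) ≤ d(Y).
  have h1 := hd.relDim_le ({a} ∪ X) (Y := {a} ∪ Y) (Z := B ∪ C) (by
    rw [Finset.coe_union, Finset.coe_singleton, Set.union_comm]
    exact Set.union_subset_union hY (Set.singleton_subset_iff.2 haC))
  have h2 : {a} ∪ X ∪ ({a} ∪ Y) = {a} ∪ X ∪ Y := by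
    ext x
    simp only [Finset.mem_union, Finset.mem_singleton]
    tauto
  rw [h2] at h1
  linarith

theorem relDim_map {g : Equiv.Perm V} (hg : g ∈ G) (X : Finset V) (Z : Set V) :
    relDim d (X.map g.toEmbedding) (g '' Z) = relDim d X Z := by
  classical
  have key : ∀ g ∈ G, ∀ (X : Finset V) (Z : Set V),
      relDim d (X.map g.toEmbedding) (g '' Z) ≤ relDim d X Z := by
    intro g hg X Z
    refine le_relDim fun Y hY => ?_
    have h1 := hd.relDim_le (X.map g.toEmbedding) (Y := Y.map g.toEmbedding) (Z := g '' Z) (by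
      rw [Finset.coe_map]
      exact Set.image_mono hY)
    rwa [← Finset.map_union, hd.invariant g hg, hd.invariant g hg] at h1
  refine (key g hg X Z).antisymm ?_
  have h1 := key g⁻¹ (G.inv_mem hg) (X.map g.toEmbedding) (g '' Z)
  have h2 : (X.map g.toEmbedding).map (g⁻¹).toEmbedding = X := by
    apply Finset.coe_injective
    rw [Finset.coe_map, Finset.coe_map]
    change ⇑g⁻¹ '' (⇑g '' (X : Set V)) = X
    rw [Set.image_image]
    simp
  have h3 : ⇑g⁻¹ '' (⇑g '' Z) = Z := by
    rw [Set.image_image]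
    simp
  rwa [h2, h3] at h1

theorem dcl_image {g : Equiv.Perm V} (hg : g ∈ G) (Z : Set V) : dcl d (g '' Z) = g '' dcl d Z := by
  have key : ∀ a, g a ∈ dcl d (g '' Z) ↔ a ∈ dcl d Z := by
    intro a
    change relDim d {g a} _ = 0 ↔ relDim d {a} _ = 0
    rw [← hd.relDim_map hg {a} Z]
    simp
  ext b
  constructor
  · intro hb
    refine ⟨g⁻¹ b, (key _).1 ?_, by simp⟩
    simpa using hb
  · rintro ⟨a, ha, rfl⟩
    exact (key a).2 ha

theorem image_mem_dClosures {g : Equiv.Perm V} (hg : g ∈ G) {A : Set V} (hA : A ∈ dClosures d) :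
    g '' A ∈ dClosures d := by
  obtain ⟨X, rfl⟩ := hA
  exact ⟨X.map g.toEmbedding, by rw [Finset.coe_map]; exact (hd.dcl_image hg _).symm⟩

/-- Existence for `d`-independence implies that `cl^d` subsumes definable closure. -/
theorem subsumesDefinableClosure (h : Existence G d) : SubsumesDefinableClosure G d := by
  classical
  intro X a hfix
  have hA : dcl d ({a} ∪ X : Finset V) ∈ dClosures d := ⟨_, rfl⟩
  -- The set is made independent from itself over cl^d(X). Since a = g a lies in both copies, it
  -- lies in the base.
  obtain ⟨g, hg, hgB, hind⟩ := h _ hA (dcl d X) ⟨X, rfl⟩ _ hA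
  have haA : a ∈ dcl d ({a} ∪ X : Finset V) := hd.subset_dcl _ (by simp)
  obtain ⟨Y, hY, hY'⟩ := hd.exists_finset_of_mem (hd.image_mem_dClosures hg hA)
  have := hd.mem_dcl_of_dIndep hY hY' hind ⟨a, haA, hfix g hg hgB⟩ haA
  rwa [hd.dcl_dcl] at this

end

end IsDimensionFunction

namespace Hypergraph

variable {r : ℕ} {V : Type u} {W : Type v} {U : Type w} {n m : ℕ}

/-! ### The extension property -/

/-- The extension property of the generic structure, for a finite subset `T` of a hypergraph on an
arbitrary type. -/
theorem IsGeneric.exists_extension [Nonempty V] {M : Hypergraph r V} (hM : M.IsGeneric n m)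
    {N : Hypergraph r U} {T : Set U} (hT : T.Finite)
    (hN : ∀ Z ⊆ T, N.predim n m ∅ ≤ N.predim n m Z)
    {X : Set V} (hX : X.Finite) (hXM : M.SelfSufficient n m X) {f : V → U}
    (hf : M.IsEmbOn N f X) (hfX : f '' X ⊆ T)
    (hle : ∀ Z ⊆ T, N.predim n m (Z ∩ f '' X) ≤ N.predim n m Z) :
    ∃ α : U → V, N.IsEmbOn M α T ∧ (∀ x ∈ X, α (f x) = x) ∧ M.SelfSufficient n m (α '' T) := by
  classical
  have := hT.to_subtype
  obtain ⟨k, ⟨e⟩⟩ := Finite.exists_equiv_fin T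
  -- The field `extension` speaks of structures on types in `Type`, so T is first copied to `Fin k`.
  let ι : Fin k → U := fun i => (e.symm i : U)
  have hι : Function.Injective ι := Subtype.val_injective.comp e.symm.injective
  have hιT : ∀ i, ι i ∈ T := fun i => (e.symm i).2
  have hιr : ι '' Set.univ = T := by
    ext u
    constructor
    · rintro ⟨i, -, rfl⟩
      exact hιT i
    · intro hu
      exact ⟨e ⟨u, hu⟩, trivial, by simp [ι]⟩
  let A : Hypergraph r (Fin k) :=
    { edges := {s | s.image ι ∈ N.edges}
      card_edge := fun s hs => by
        rw [← N.card_edge _ hs, Finset.card_image_of_injective _ hι] }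
  have hA : A.IsEmbOn N ι Set.univ := ⟨hι.injOn, fun s _ => Iff.rfl⟩
  have hAp : ∀ Z : Set (Fin k), N.predim n m (ι '' Z) = A.predim n m Z := fun Z =>
    hA.predim_image (Set.subset_univ _)
  have hιsub : ∀ Z : Set (Fin k), ι '' Z ⊆ T := by
    rintro Z _ ⟨i, -, rfl⟩
    exact hιT i
  let f₀ : X ↪ Fin k :=
    ⟨fun x => e ⟨f x, hfX ⟨x, x.2, rfl⟩⟩, fun x y hxy => by
      have h1 := congrArg Subtype.val (e.injective hxy)
      exact Subtype.ext (hf.1 x.2 y.2 h1)⟩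
  have hf₀ : ∀ x, ι (f₀ x) = f x := fun x => by
    change ((e.symm (e _) : T) : U) = _
    rw [e.symm_apply_apply]
  have hrange : ι '' Set.range f₀ = f '' X := by
    ext u
    constructor
    · rintro ⟨_, ⟨x, rfl⟩, rfl⟩
      exact ⟨x, x.2, (hf₀ x).symm⟩
    · rintro ⟨x, hx, rfl⟩
      exact ⟨_, ⟨⟨x, hx⟩, rfl⟩, hf₀ _⟩
  obtain ⟨α₀, h1, h2, h3⟩ := hM.extension X hX hXM (Fin k) A
    (fun Y _ => ⟨Set.empty_subset _, fun B _ _ => by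
      rw [← hAp, ← hAp, Set.image_empty]
      exact hN _ (hιsub _)⟩)
    f₀
    (fun s => by
      have h1 := hf.2 (s.map (Function.Embedding.subtype _)) (by
        intro x hx
        simp only [Finset.coe_map, Set.mem_image] at hx
        obtain ⟨y, -, rfl⟩ := hx
        exact y.2)
      change s.map (Function.Embedding.subtype _) ∈ M.edges ↔ (s.map f₀).image ι ∈ N.edges
      rw [h1, Finset.map_eq_image, Finset.map_eq_image, Finset.image_image, Finset.image_image,
        show ι ∘ f₀ = f ∘ Function.Embedding.subtype _ from funext hf₀])
    (selfSufficient_of_predim_inter_le fun Z _ => by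
      rw [← hAp, ← hAp, Set.image_inter hι, hrange]
      exact hle _ (hιsub _))
  -- The values off T are never used.
  let α : U → V := Function.extend ι α₀ fun _ => Classical.arbitrary V
  have hα : ∀ i, α (ι i) = α₀ i := fun i => hι.extend_apply _ _ i
  refine ⟨α, ?_, ?_, ?_⟩
  · rw [← hιr]
    refine ⟨?_, fun s hs => ?_⟩
    · rintro _ ⟨i, -, rfl⟩ _ ⟨j, -, rfl⟩ hij
      rw [hα, hα] at hij
      rw [α₀.injective hij]
    · obtain ⟨s', -, rfl⟩ := exists_finset_image_eq hs
      rw [Finset.image_image, show α ∘ ι = α₀ from funext hα, ← Finset.map_eq_image, ← h1]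
      rfl
  · intro x hx
    rw [← hf₀ ⟨x, hx⟩, hα, h2]
  · have : α '' T = Set.range α₀ := by
      rw [← hιr, ← Set.image_comp, show α ∘ ι = α₀ from funext hα, Set.image_univ]
    rwa [this]

/-- Embeddings of finite self-sufficient sets onto self-sufficient sets can be extended. -/
theorem IsGeneric.exists_extension_of_isEmbOn [Nonempty V] {M : Hypergraph r V}
    (hM : M.IsGeneric n m) {D E : Set V} (hE : E.Finite) (hDE : D ⊆ E)
    (hD : M.SelfSufficient n m D) {f : V → V} (hf : M.IsEmbOn M f D)
    (hfD : M.SelfSufficient n m (f '' D)) :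
    ∃ k : V → V, M.IsEmbOn M k E ∧ Set.EqOn k f D ∧ M.SelfSufficient n m (k '' E) := by
  have hg : ∀ x ∈ D, Function.invFunOn f D (f x) = x := hf.1.leftInvOn_invFunOn
  have hgi : Function.invFunOn f D '' (f '' D) = D := by
    rw [Set.image_image]
    exact (Set.image_congr hg).trans (Set.image_id D)
  obtain ⟨α, h1, h2, h3⟩ := hM.exists_extension (N := M) hE
    (fun Z hZ => (hM.inC0 Z (hE.subset hZ)).2 Z (Set.empty_subset _) le_rfl)
    ((hE.subset hDE).image f) hfD (hf.leftInverse hg) (by rwa [hgi])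
    (fun Z hZ => by
      rw [hgi]
      exact hD.predim_inter_le (hE.subset hZ))
  refine ⟨α, h1, fun x hx => ?_, h3⟩
  have := h2 _ (Set.mem_image_of_mem f hx)
  rwa [hg x hx] at this

/-! ### The closure and self-sufficient sets -/

section

variable {M : Hypergraph r V} (hr : 1 ≤ r) (hM : M.InC0 n m)
include hr hM

theorem setRank_union_of_subset_dcl {E F : Set V} (hE : E.Finite) (hF : F.Finite)
    (h : E ⊆ dcl (M.dim n m) F) : M.setRank n m (E ∪ F) = M.setRank n m F := by
  classical
  lift E to Finset V using hE
  lift F to Finset V using hF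
  have := (isDimensionFunction_dim hM hr).union_eq_of_subset_dcl h
  rwa [dim_eq_setRank, dim_eq_setRank, Finset.coe_union] at this

theorem predim_eq_of_subset_dcl {E F : Set V} (hE : E.Finite) (hFE : F ⊆ E)
    (hEs : M.SelfSufficient n m E) (hFs : M.SelfSufficient n m F)
    (h : E ⊆ dcl (M.dim n m) F) : M.predim n m E = M.predim n m F := by
  have h1 := setRank_union_of_subset_dcl hr hM hE (hE.subset hFE) h
  rwa [Set.union_eq_left.2 hFE, hEs.setRank_eq, hFs.setRank_eq] at h1

theorem mem_dcl_of_predim_le {F Z : Set V} (hF : M.SelfSufficient n m F) (hZ : Z.Finite)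
    (hFZ : F ⊆ Z) (h : M.predim n m Z ≤ M.predim n m F) {a : V} (ha : a ∈ Z) :
    a ∈ dcl (M.dim n m) F := by
  classical
  have hFf := hZ.subset hFZ
  lift F to Finset V using hFf
  refine (isDimensionFunction_dim hM hr).mem_dcl_of_le (Y := F) le_rfl ?_
  rw [dim_eq_setRank, dim_eq_setRank, Finset.coe_union, Finset.coe_singleton, hF.setRank_eq]
  exact (setRank_le_predim hM (Set.union_subset (Set.singleton_subset_iff.2 ha) hFZ) hZ).trans h

theorem cl0_subset_dcl {X : Set V} (hX : X.Finite) : M.cl0 n m X ⊆ dcl (M.dim n m) X := by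
  classical
  intro a ha
  obtain ⟨h1, h2, h3⟩ := cl0_spec hM hX
  lift X to Finset V using hX
  refine (isDimensionFunction_dim hM hr).mem_dcl_of_le (Y := X) le_rfl ?_
  rw [dim_eq_setRank, dim_eq_setRank, Finset.coe_union, Finset.coe_singleton]
  exact setRank_le_predim hM (Set.union_subset (Set.singleton_subset_iff.2 ha) h3) h1

theorem selfSufficient_of_dcl_eq {A : Set V} (hA : dcl (M.dim n m) A = A) :
    M.SelfSufficient n m A := by
  refine selfSufficient_of_cl0_subset hM fun X hX hXA => ?_
  have h := (isDimensionFunction_dim hM hr).dcl_mono hXA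
  rw [hA] at h
  exact (cl0_subset_dcl hr hM hX).trans h

end

/-- `D` is freely amalgamated with, and self-sufficient over, all large enough finite
self-sufficient subsets of `P`. -/
def FreeOver (n m : ℕ) (M : Hypergraph r V) (D P : Set V) : Prop :=
  ∀ E : Set V, E.Finite → M.SelfSufficient n m E → D ∩ P ⊆ E → E ⊆ P →
    M.SelfSufficient n m (D ∪ E) ∧ M.FreelyAmalgamated D E

/-- Since d(D ∪ E) ≤ δ(D ∪ E) ≤ δ(D) + δ(E) − δ(D ∩ E), the hypothesis makes all three equal. The
first equality gives self-sufficiency, the second freeness. -/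
theorem selfSufficient_union_and_free_of_predim_le (hm : 1 ≤ m) {M : Hypergraph r V}
    (hM : M.InC0 n m) {D E : Set V} (hD : D.Finite) (hE : E.Finite)
    (h : M.predim n m D + M.predim n m E ≤ M.setRank n m (D ∪ E) + M.predim n m (D ∩ E)) :
    M.SelfSufficient n m (D ∪ E) ∧ M.FreelyAmalgamated D E := by
  have h1 := M.predim_submodular n m hD hE
  have h2 := setRank_le_predim hM (le_refl (D ∪ E)) (hD.union hE)
  exact ⟨selfSufficient_of_predim_le_setRank hM (hD.union hE) (by linarith),
    freelyAmalgamated_of_predim_le hm hD hE (by linarith)⟩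

/-- If D ∩ P spans P, then δ(E) = δ(D ∩ P) for each E in question, so the required lower bound on
d(D ∪ E) is just δ(D) = d(D) ≤ d(D ∪ E). -/
theorem freeOver_of_subset_dcl (hr : 1 ≤ r) (hm : 1 ≤ m) {M : Hypergraph r V} (hM : M.InC0 n m)
    {D P : Set V} (hD : D.Finite) (hDs : M.SelfSufficient n m D) (hP : M.SelfSufficient n m P)
    (h : P ⊆ dcl (M.dim n m) (D ∩ P)) : M.FreeOver n m D P := by
  intro E hE hEs hDE hEP
  have h1 : M.predim n m E = M.predim n m (D ∩ P) :=
    predim_eq_of_subset_dcl hr hM hE hDE hEs (hDs.inter hP) (hEP.trans h)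
  have h2 : D ∩ E = D ∩ P :=
    (Set.inter_subset_inter_right D hEP).antisymm (Set.subset_inter Set.inter_subset_left hDE)
  have h3 := setRank_mono hM (Set.subset_union_left : D ⊆ D ∪ E) (hD.union hE)
  rw [hDs.setRank_eq] at h3
  refine selfSufficient_union_and_free_of_predim_le hm hM hD hE ?_
  rw [h1, h2]
  linarith

/-- Every finite subset S of D ∪ P is caught by D together with the finite closure of (S ∩ P) ∪ (D ∩
P), which stays inside P. -/
theorem FreeOver.union {M : Hypergraph r V} (hM : M.InC0 n m) {D P : Set V} (hD : D.Finite)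
    (hP : M.SelfSufficient n m P) (h : M.FreeOver n m D P) :
    M.SelfSufficient n m (D ∪ P) ∧ M.FreelyAmalgamated D P := by
  refine selfSufficient_union_and_freelyAmalgamated hM fun S hS hSDP => ?_
  have hf : ((S ∩ P) ∪ (D ∩ P)).Finite := (hS.inter_of_left P).union (hD.inter_of_left P)
  obtain ⟨h1, h2, h3⟩ := cl0_spec hM hf
  have h4 : M.cl0 n m ((S ∩ P) ∪ (D ∩ P)) ⊆ P :=
    cl0_subset (Set.union_subset Set.inter_subset_right Set.inter_subset_right) hP
  refine ⟨D, _, le_rfl, h4, ?_, h _ h1 h2 (Set.subset_union_right.trans h3) h4⟩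
  intro x hx
  exact (hSDP hx).imp id fun hxP => h3 (Or.inl ⟨hx, hxP⟩)

end Hypergraph

/-! ### Back and forth -/

section BackAndForth

variable {V : Type u}

/-- `f'` extends `f`. -/
def Extends (f f' : PartialEquiv V V) : Prop :=
  f.source ⊆ f'.source ∧ Set.EqOn f' f f.source

theorem Extends.refl (f : PartialEquiv V V) : Extends f f := ⟨le_rfl, fun _ _ => rfl⟩

theorem Extends.trans {f g h : PartialEquiv V V} (h1 : Extends f g) (h2 : Extends g h) :
    Extends f h :=
  ⟨h1.1.trans h2.1, fun x hx => by rw [h2.2 (h1.1 hx), h1.2 hx]⟩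

theorem Extends.symm {f f' : PartialEquiv V V} (h : Extends f f') : Extends f.symm f'.symm := by
  have key : ∀ y ∈ f.target, y ∈ f'.target ∧ f'.symm y = f.symm y := by
    intro y hy
    have h1 := f.map_target hy
    have h2 : f' (f.symm y) = y := by rw [h.2 h1, f.right_inv hy]
    have h3 := f'.map_source (h.1 h1)
    have h4 := f'.left_inv (h.1 h1)
    rw [h2] at h3 h4
    exact ⟨h3, h4⟩
  exact ⟨fun y hy => (key y hy).1, fun y hy => (key y hy).2⟩

/-- The limit agrees on each finite set with one approximation. That is all that is needed later,
since edges are finite. -/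
theorem exists_perm_of_backAndForth [Countable V] [Nonempty V] {p : PartialEquiv V V → Prop}
    {f₀ : PartialEquiv V V} (h₀ : p f₀)
    (step : ∀ f, p f → ∀ b, ∃ f', p f' ∧ Extends f f' ∧ b ∈ f'.source ∧ b ∈ f'.target) :
    ∃ g : Equiv.Perm V, ∀ S : Set V, S.Finite → ∃ f, p f ∧ S ⊆ f.source ∧ Set.EqOn g f S := by
  obtain ⟨e, he⟩ := exists_surjective_nat V
  choose s hp hext hsrc htgt using step
  let F : ℕ → {f // p f} := fun k => Nat.rec ⟨f₀, h₀⟩ (fun k f => ⟨s f.1 f.2 (e k), hp _ _ _⟩) k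
  have hF : ∀ i j, i ≤ j → Extends (F i).1 (F j).1 := by
    intro i j hij
    induction hij with
    | refl => exact Extends.refl _
    | step _ ih => exact ih.trans (hext _ _ _)
  have hS : ∀ x, ∃ k, x ∈ (F k).1.source := by
    intro x
    obtain ⟨k, rfl⟩ := he x
    exact ⟨k + 1, hsrc _ _ _⟩
  have hT : ∀ x, ∃ k, x ∈ (F k).1.target := by
    intro x
    obtain ⟨k, rfl⟩ := he x
    exact ⟨k + 1, htgt _ _ _⟩
  choose a ha using hS
  choose b hb using hT
  have hg : ∀ x k, x ∈ (F k).1.source → (F k).1 x = (F (a x)).1 x := by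
    intro x k hk
    rw [← (hF _ _ (le_max_left k (a x))).2 hk, (hF _ _ (le_max_right k (a x))).2 (ha x)]
  have hg' : ∀ x k, x ∈ (F k).1.target → (F k).1.symm x = (F (b x)).1.symm x := by
    intro x k hk
    rw [← (hF _ _ (le_max_left k (b x))).symm.2 hk,
      (hF _ _ (le_max_right k (b x))).symm.2 (hb x)]
  refine ⟨⟨fun x => (F (a x)).1 x, fun y => (F (b y)).1.symm y, fun x => ?_, fun y => ?_⟩, ?_⟩
  · simp only
    rw [← hg' _ (a x) ((F (a x)).1.map_source (ha x)), (F (a x)).1.left_inv (ha x)]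
  · simp only
    rw [← hg _ (b y) ((F (b y)).1.map_target (hb y)), (F (b y)).1.right_inv (hb y)]
  · intro S hSf
    obtain ⟨k, hk⟩ : ∃ k, ∀ x ∈ S, a x ≤ k := by
      obtain ⟨k, hk⟩ := (hSf.image a).bddAbove
      exact ⟨k, fun x hx => hk ⟨x, hx, rfl⟩⟩
    have hsub : S ⊆ (F k).1.source := fun x hx => (hF _ _ (hk x hx)).1 (ha x)
    exact ⟨(F k).1, (F k).2, hsub, fun x hx => (hg x k (hsub hx)).symm⟩

end BackAndForth

namespace Hypergraph

variable {r : ℕ} {V : Type u} {n m : ℕ}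

/-! ### Extending isomorphisms of free amalgams of `d`-closed or finite sets -/

/-- `A ∪ C` is a self-sufficient free amalgam of two self-sufficient sets, each of which is finite
or `d`-closed, and it is contained in the `d`-closure of a finite set. -/
structure IsTameAmalgam (n m : ℕ) (M : Hypergraph r V) (A C : Set V) : Prop where
  left : M.SelfSufficient n m A
  right : M.SelfSufficient n m C
  union : M.SelfSufficient n m (A ∪ C)
  free : M.FreelyAmalgamated A C
  left_closed : A.Finite ∨ dcl (M.dim n m) A = A
  right_closed : C.Finite ∨ dcl (M.dim n m) C = C
  basis : ∃ X : Finset V, A ∪ C ⊆ dcl (M.dim n m) X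

/-- `h` is an isomorphism of tame amalgams. -/
structure IsAmalgamIso (n m : ℕ) (M : Hypergraph r V) (h : PartialEquiv V V)
    (A₁ C₁ A₂ C₂ : Set V) : Prop where
  source_eq : h.source = A₁ ∪ C₁
  emb : M.IsEmbOn M h (A₁ ∪ C₁)
  image_left : h '' A₁ = A₂
  image_right : h '' C₁ = C₂
  fst : M.IsTameAmalgam n m A₁ C₁
  snd : M.IsTameAmalgam n m A₂ C₂

namespace IsAmalgamIso

variable {M : Hypergraph r V} {h : PartialEquiv V V} {A₁ C₁ A₂ C₂ : Set V}

theorem target_eq (H : M.IsAmalgamIso n m h A₁ C₁ A₂ C₂) : h.target = A₂ ∪ C₂ := by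
  rw [← h.image_source_eq_target, H.source_eq, Set.image_union, H.image_left, H.image_right]

theorem symm (H : M.IsAmalgamIso n m h A₁ C₁ A₂ C₂) :
    M.IsAmalgamIso n m h.symm A₂ C₂ A₁ C₁ := by
  have key : ∀ x ∈ A₁ ∪ C₁, h.symm (h x) = x := fun x hx =>
    h.left_inv (by rwa [H.source_eq])
  have aux : ∀ X ⊆ A₁ ∪ C₁, h.symm '' (h '' X) = X := fun X hX => by
    rw [Set.image_image]
    exact (Set.image_congr fun x hx => key x (hX hx)).trans (Set.image_id X)
  have h1 := H.emb.leftInverse key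
  rw [Set.image_union, H.image_left, H.image_right] at h1
  exact ⟨H.target_eq, h1, by rw [← H.image_left, aux _ Set.subset_union_left],
    by rw [← H.image_right, aux _ Set.subset_union_right], H.snd, H.fst⟩

variable (H : M.IsAmalgamIso n m h A₁ C₁ A₂ C₂)
include H

theorem mem_left_iff {x : V} (hx : x ∈ A₁ ∪ C₁) : h x ∈ A₂ ↔ x ∈ A₁ := by
  rw [← H.image_left]
  exact H.emb.1.mem_image_iff Set.subset_union_left hx

theorem mem_right_iff {x : V} (hx : x ∈ A₁ ∪ C₁) : h x ∈ C₂ ↔ x ∈ C₁ := by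
  rw [← H.image_right]
  exact H.emb.1.mem_image_iff Set.subset_union_right hx

/-- Extensions of large enough finite parts of `h` do not meet the range of `h` more than
necessary. -/
theorem exists_control (hr : 1 ≤ r) (hM : M.InC0 n m) :
    ∃ F : Set V, F.Finite ∧ F ⊆ A₁ ∪ C₁ ∧ A₁ ∪ C₁ ⊆ dcl (M.dim n m) F ∧
      ∀ D : Set V, D.Finite → M.SelfSufficient n m D → F ⊆ D → ∀ φ : V → V, M.IsEmbOn M φ D →
        M.SelfSufficient n m (φ '' D) → Set.EqOn φ h (D ∩ (A₁ ∪ C₁)) →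
        φ '' D ∩ (A₂ ∪ C₂) ⊆ φ '' (D ∩ (A₁ ∪ C₁)) ∧
        A₂ ∪ C₂ ⊆ dcl (M.dim n m) (φ '' (D ∩ (A₁ ∪ C₁))) := by
  have hd := isDimensionFunction_dim hM hr
  obtain ⟨X₁, hX₁⟩ := H.fst.basis
  obtain ⟨X₂, hX₂⟩ := H.snd.basis
  obtain ⟨F₁, hF₁, hF₁'⟩ := hd.exists_finset_basis hX₁
  obtain ⟨F₂, hF₂, hF₂'⟩ := hd.exists_finset_basis hX₂
  obtain ⟨B₂, hB₂, hB₂'⟩ := hd.exists_finset_basis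
    ((Set.inter_subset_left.trans Set.subset_union_left : A₂ ∩ C₂ ⊆ A₂ ∪ C₂).trans hX₂)
  have htgt : ∀ y ∈ A₂ ∪ C₂, h.symm y ∈ A₁ ∪ C₁ ∧ h (h.symm y) = y := by
    intro y hy
    rw [← H.target_eq] at hy
    rw [← H.source_eq]
    exact ⟨h.map_target hy, h.right_inv hy⟩
  -- K contains a set spanning P = A₁ ∪ C₁, and its image under h contains sets spanning Q = A₂ ∪ C₂
  -- and A₂ ∩ C₂.
  let K : Set V := F₁ ∪ (h.symm '' F₂ ∪ h.symm '' B₂)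
  have hK : K ⊆ A₁ ∪ C₁ := by
    rintro x (hx | ⟨y, hy, rfl⟩ | ⟨y, hy, rfl⟩)
    · exact hF₁ hx
    · exact (htgt y (hF₂ hy)).1
    · exact (htgt y (Or.inl (hB₂ hy).1)).1
  -- This is A itself when A is finite and ∅ otherwise. A finite piece need not be d-closed, so it
  -- is put into F entirely.
  let L (A : Set V) : Set V := {x ∈ A | A.Finite}
  have hL : ∀ A, (L A).Finite := by
    intro A
    by_cases hA : A.Finite
    · exact hA.subset fun x hx => hx.1
    · exact Set.finite_empty.subset fun x hx => hA hx.2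
  refine ⟨K ∪ (L A₁ ∪ L C₁), ?_, ?_, ?_, ?_⟩
  · exact ((F₁.finite_toSet.union ((F₂.finite_toSet.image _).union
      (B₂.finite_toSet.image _)))).union ((hL _).union (hL _))
  · exact Set.union_subset hK (Set.union_subset_union (fun x hx => hx.1) (fun x hx => hx.1))
  · exact hF₁'.trans (hd.dcl_mono (Set.subset_union_left.trans Set.subset_union_left))
  intro D hD hDs hFD φ hφ hφD heq
  have hKD : K ⊆ D := Set.subset_union_left.trans hFD
  have hmem : ∀ y ∈ A₂ ∪ C₂, h.symm y ∈ D → φ (h.symm y) = y := fun y hy hyD => by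
    rw [heq ⟨hyD, (htgt y hy).1⟩, (htgt y hy).2]
  have hφl : ∀ x ∈ D, x ∈ A₁ ∪ C₁ → (φ x ∈ A₂ ↔ x ∈ A₁) := fun x hx hx' => by
    rw [heq ⟨hx, hx'⟩, H.mem_left_iff hx']
  have hφr : ∀ x ∈ D, x ∈ A₁ ∪ C₁ → (φ x ∈ C₂ ↔ x ∈ C₁) := fun x hx hx' => by
    rw [heq ⟨hx, hx'⟩, H.mem_right_iff hx']
  have hF₂D : (F₂ : Set V) ⊆ φ '' (D ∩ (A₁ ∪ C₁)) := by
    intro y hy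
    have h1 : h.symm y ∈ D := hKD (Or.inr (Or.inl ⟨y, hy, rfl⟩))
    exact ⟨_, ⟨h1, (htgt y (hF₂ hy)).1⟩, hmem y (hF₂ hy) h1⟩
  have hB₂D : (B₂ : Set V) ⊆ φ '' (D ∩ (A₁ ∩ C₁)) := by
    intro y hy
    have h1 : h.symm y ∈ D := hKD (Or.inr (Or.inr ⟨y, hy, rfl⟩))
    have hy' := hB₂ hy
    have h2 := (htgt y (Or.inl hy'.1)).1
    have h3 := hmem y (Or.inl hy'.1) h1
    refine ⟨_, ⟨h1, ?_, ?_⟩, h3⟩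
    · rw [← hφl _ h1 h2, h3]
      exact hy'.1
    · rw [← hφr _ h1 h2, h3]
      exact hy'.2
  have hspan : A₂ ∪ C₂ ⊆ dcl (M.dim n m) (φ '' (D ∩ (A₁ ∪ C₁))) := hF₂'.trans (hd.dcl_mono hF₂D)
  refine ⟨?_, hspan⟩
  have hφf : (φ '' D).Finite := hD.image φ
  have hpre : ∀ X ⊆ D, M.predim n m (φ '' X) = M.predim n m X := fun X hX => hφ.predim_image hX
  have hss : ∀ P, M.SelfSufficient n m P → M.SelfSufficient n m (φ '' (D ∩ P)) := fun P hP =>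
    hφ.selfSufficient_image hφD (hD.inter_of_left P) Set.inter_subset_left (hDs.inter hP)
  -- Both φ(D) ∩ Q and its subset φ(D ∩ P) are self-sufficient, and the smaller spans Q, so δ
  -- agrees. The same holds for the intersections in `e2`.
  have e1 : M.predim n m (φ '' D ∩ (A₂ ∪ C₂)) = M.predim n m (D ∩ (A₁ ∪ C₁)) := by
    rw [← hpre _ Set.inter_subset_left]
    refine predim_eq_of_subset_dcl hr hM (hφf.inter_of_left _) ?_ (hφD.inter H.snd.union)
      (hss _ H.fst.union) (Set.inter_subset_right.trans hspan)
    rintro _ ⟨x, ⟨hx, hx'⟩, rfl⟩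
    exact ⟨⟨x, hx, rfl⟩, hx'.imp (hφl x hx hx').2 (hφr x hx hx').2⟩
  have e2 : M.predim n m (φ '' D ∩ (A₂ ∩ C₂)) = M.predim n m (D ∩ (A₁ ∩ C₁)) := by
    rw [← hpre _ Set.inter_subset_left]
    refine predim_eq_of_subset_dcl hr hM (hφf.inter_of_left _) ?_
      (hφD.inter (H.snd.left.inter H.snd.right)) (hss _ (H.fst.left.inter H.fst.right))
      (Set.inter_subset_right.trans (hB₂'.trans (hd.dcl_mono hB₂D)))
    rintro _ ⟨x, ⟨hx, hx1, hx2⟩, rfl⟩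
    exact ⟨⟨x, hx, rfl⟩, (hφl x hx (Or.inl hx1)).2 hx1, (hφr x hx (Or.inl hx1)).2 hx2⟩
  have f1 := (H.fst.free.inter D).predim_union_add_inter (n := n) (m := m)
    (hD.inter_of_left _) (hD.inter_of_left _)
  have f2 := (H.snd.free.inter (φ '' D)).predim_union_add_inter (n := n) (m := m)
    (hφf.inter_of_left _) (hφf.inter_of_left _)
  rw [← Set.inter_union_distrib_left, ← Set.inter_inter_distrib_left] at f1 f2
  have sub1 : φ '' (D ∩ A₁) ⊆ φ '' D ∩ A₂ := by
    rintro _ ⟨x, ⟨hx, hx'⟩, rfl⟩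
    exact ⟨⟨x, hx, rfl⟩, (hφl x hx (Or.inl hx')).2 hx'⟩
  have sub2 : φ '' (D ∩ C₁) ⊆ φ '' D ∩ C₂ := by
    rintro _ ⟨x, ⟨hx, hx'⟩, rfl⟩
    exact ⟨⟨x, hx, rfl⟩, (hφr x hx (Or.inr hx')).2 hx'⟩
  -- By freeness on both sides, `e1` and `e2` make the sums of δ over the two pieces equal. Neither
  -- piece can lose δ, so each keeps its value.
  have le1 := (hss _ H.fst.left).predim_le (hφf.inter_of_left A₂) sub1
  have le2 := (hss _ H.fst.right).predim_le (hφf.inter_of_left C₂) sub2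
  rw [hpre _ Set.inter_subset_left] at le1 le2
  have key : ∀ P Q : Set V, M.SelfSufficient n m P → (P.Finite ∨ dcl (M.dim n m) P = P) →
      L P ⊆ D → h '' P = Q → P ⊆ A₁ ∪ C₁ → φ '' (D ∩ P) ⊆ φ '' D ∩ Q →
      M.predim n m (φ '' D ∩ Q) ≤ M.predim n m (D ∩ P) → φ '' D ∩ Q ⊆ φ '' (D ∩ P) := by
    intro P Q hP hPc hLP hPQ hPs hsub hle
    rcases hPc with hPf | hPc
    · rintro y ⟨-, hy⟩
      rw [← hPQ] at hy
      obtain ⟨x, hx, rfl⟩ := hy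
      have hxD : x ∈ D := hLP ⟨hx, hPf⟩
      exact ⟨x, ⟨hxD, hx⟩, heq ⟨hxD, hPs hx⟩⟩
    · obtain ⟨Y, hY, hYQ⟩ := Set.subset_image_iff.1 (Set.inter_subset_left : φ '' D ∩ Q ⊆ φ '' D)
      rw [← hYQ] at hsub hle ⊢
      rw [hpre Y hY] at hle
      have hsub' : D ∩ P ⊆ Y := (hφ.1.image_subset_image_iff Set.inter_subset_left hY).1 hsub
      refine Set.image_mono (Set.subset_inter hY fun y hy => ?_)
      -- The part Y of D mapped into Q contains D ∩ P and has no larger δ, so it lies in cl^d(D ∩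
      -- P), hence in the d-closed piece P.
      have h1 := mem_dcl_of_predim_le hr hM (hDs.inter hP) (hD.subset hY) hsub' hle hy
      rw [← hPc]
      exact hd.dcl_mono Set.inter_subset_right h1
  have c1 := key A₁ A₂ H.fst.left H.fst.left_closed
    ((Set.subset_union_left.trans Set.subset_union_right).trans hFD) H.image_left
    Set.subset_union_left sub1 (by linarith)
  have c2 := key C₁ C₂ H.fst.right H.fst.right_closed
    ((Set.subset_union_right.trans Set.subset_union_right).trans hFD) H.image_right
    Set.subset_union_right sub2 (by linarith)
  rw [Set.inter_union_distrib_left, Set.inter_union_distrib_left, Set.image_union]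
  exact Set.union_subset_union c1 c2

end IsAmalgamIso

/-- `f` is a finite partial isomorphism which is compatible with `h : P → Q` and can be extended to
an automorphism together with `h`. -/
structure IsApprox (n m : ℕ) (M : Hypergraph r V) (P Q : Set V) (h f : PartialEquiv V V) :
    Prop where
  finite : f.source.Finite
  emb : M.IsEmbOn M f f.source
  source : M.SelfSufficient n m f.source
  target : M.SelfSufficient n m f.target
  free_source : M.FreeOver n m f.source P
  free_target : M.FreeOver n m f.target Q
  mem_iff : ∀ x ∈ f.source, f x ∈ Q ↔ x ∈ P
  eqOn : Set.EqOn f h (f.source ∩ P)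

namespace IsApprox

variable {M : Hypergraph r V} {h f : PartialEquiv V V} {P Q : Set V}

theorem finite_target (hf : M.IsApprox n m P Q h f) : f.target.Finite := by
  rw [← f.image_source_eq_target]
  exact hf.finite.image f

theorem symm (hf : M.IsApprox n m P Q h f) (hP : h.source = P) :
    M.IsApprox n m Q P h.symm f.symm := by
  have hmem : ∀ y ∈ f.target, f.symm y ∈ P ↔ y ∈ Q := fun y hy => by
    rw [← hf.mem_iff _ (f.map_target hy), f.right_inv hy]
  have h1 := hf.emb.leftInverse (g := f.symm) fun x hx => f.left_inv hx
  rw [f.image_source_eq_target] at h1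
  refine ⟨hf.finite_target, h1, hf.target, hf.source, hf.free_target, hf.free_source, hmem, ?_⟩
  rintro y ⟨hy, hyQ⟩
  have hyP := (hmem y hy).2 hyQ
  have h2 := hf.eqOn ⟨f.map_target hy, hyP⟩
  rw [f.right_inv hy] at h2
  rw [← hP] at hyP
  have h3 := h.left_inv hyP
  rw [← h2] at h3
  exact h3.symm

/-- Freeness of f over P and Q allows f to be glued to h on D ∩ P, where D is the closure of the old
domain, b and the control set F. Genericity extends the glued map to D, and the control set restores
the invariants. -/
theorem forth [Nonempty V] (hr : 1 ≤ r) (hm : 1 ≤ m) (hM : M.IsGeneric n m) {A₁ C₁ A₂ C₂ : Set V}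
    (H : M.IsAmalgamIso n m h A₁ C₁ A₂ C₂) (hf : M.IsApprox n m (A₁ ∪ C₁) (A₂ ∪ C₂) h f) (b : V) :
    ∃ f', M.IsApprox n m (A₁ ∪ C₁) (A₂ ∪ C₂) h f' ∧ Extends f f' ∧ b ∈ f'.source := by
  obtain ⟨F, hFf, hFP, hF, hctrl⟩ := H.exists_control hr hM.inC0
  have hd := isDimensionFunction_dim hM.inC0 hr
  have hQ : h '' (A₁ ∪ C₁) = A₂ ∪ C₂ := by rw [Set.image_union, H.image_left, H.image_right]
  have hPs := H.fst.union
  have hQs := H.snd.union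
  have hemb := H.emb
  have hmapQ : ∀ x ∈ A₁ ∪ C₁, h x ∈ A₂ ∪ C₂ := fun x hx => hQ ▸ Set.mem_image_of_mem h hx
  generalize A₁ ∪ C₁ = P at *
  generalize A₂ ∪ C₂ = Q at *
  obtain ⟨hD, hDs, hsub⟩ := cl0_spec hM.inC0 (hf.finite.union (hFf.insert b))
  generalize M.cl0 n m (f.source ∪ insert b F) = D at hD hDs hsub
  have hfD : f.source ⊆ D := Set.subset_union_left.trans hsub
  have hFD : F ⊆ D := ((Set.subset_insert b F).trans Set.subset_union_right).trans hsub
  have hEs := hDs.inter hPs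
  have hEf := hD.inter_of_left P
  have hhE : M.SelfSufficient n m (h '' (D ∩ P)) :=
    hemb.selfSufficient_image (by rwa [hQ]) hEf Set.inter_subset_right hEs
  have hfree := hf.free_source _ hEf hEs (Set.inter_subset_inter_left P hfD) Set.inter_subset_right
  have hfree' := hf.free_target _ (hEf.image h) hhE (by
    rintro y ⟨hy, hyQ⟩
    have h1 := f.map_target hy
    have h2 : f.symm y ∈ P := by rwa [← hf.mem_iff _ h1, f.right_inv hy]
    exact ⟨f.symm y, ⟨hfD h1, h2⟩, by rw [← hf.eqOn ⟨h1, h2⟩, f.right_inv hy]⟩) (by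
    rintro _ ⟨x, hx, rfl⟩
    exact hmapQ x hx.2)
  obtain ⟨k, hk1, hk2, hk⟩ := hf.emb.union (hemb.mono Set.inter_subset_right)
    (fun x hx => hf.eqOn ⟨hx.1, hx.2.2⟩)
    (by
      rintro x hx ⟨y, hy, hyx⟩
      refine ⟨hfD hx, (hf.mem_iff x hx).1 ?_⟩
      rw [← hyx]
      exact hmapQ y hy.2)
    hfree.2 (by rw [f.image_source_eq_target]; exact hfree'.2)
  have hkimg : k '' (f.source ∪ D ∩ P) = f.target ∪ h '' (D ∩ P) := by
    rw [Set.image_union, hk1.image_eq, hk2.image_eq, f.image_source_eq_target]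
  obtain ⟨φ, hφ, hφk, hφs⟩ := hM.exists_extension_of_isEmbOn hD
    (Set.union_subset hfD Set.inter_subset_left) hfree.1 hk (by rw [hkimg]; exact hfree'.1)
  have hφh : Set.EqOn φ h (D ∩ P) := fun x hx => by rw [hφk (Or.inr hx), hk2 hx]
  have hφf : Set.EqOn φ f f.source := fun x hx => by rw [hφk (Or.inl hx), hk1 hx]
  obtain ⟨hc1, hc2⟩ := hctrl D hD hDs hFD φ hφ hφs hφh
  refine ⟨hφ.1.toPartialEquiv, ⟨hD, hφ, hDs, hφs, ?_, ?_, ?_, hφh⟩, ⟨hfD, hφf⟩,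
    hsub (Or.inr (Set.mem_insert b F))⟩
  · exact freeOver_of_subset_dcl hr hm hM.inC0 hD hDs hPs
      (hF.trans (hd.dcl_mono (Set.subset_inter hFD hFP)))
  · refine freeOver_of_subset_dcl hr hm hM.inC0 (hD.image φ) hφs hQs
      (hc2.trans (hd.dcl_mono (Set.subset_inter (Set.image_mono Set.inter_subset_left) ?_)))
    rintro _ ⟨x, hx, rfl⟩
    rw [hφh hx]
    exact hmapQ x hx.2
  · intro x hx
    change φ x ∈ Q ↔ x ∈ P
    constructor
    · intro hxQ
      exact ((hφ.1.mem_image_iff Set.inter_subset_left hx).1 (hc1 ⟨⟨x, hx, rfl⟩, hxQ⟩)).2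
    · intro hxP
      rw [hφh ⟨hx, hxP⟩]
      exact hmapQ x hxP

end IsApprox

/-- Isomorphisms of tame amalgams in the generic structure extend to automorphisms. -/
theorem IsAmalgamIso.exists_mem_aut [Nonempty V] (hr : 1 ≤ r) (hm : 1 ≤ m) {M : Hypergraph r V}
    (hM : M.IsGeneric n m) {h : PartialEquiv V V} {A₁ C₁ A₂ C₂ : Set V}
    (H : M.IsAmalgamIso n m h A₁ C₁ A₂ C₂) :
    ∃ g ∈ M.aut, ∀ x ∈ A₁ ∪ C₁, g x = h x := by
  classical
  have := hM.countable
  have hempty := selfSufficient_empty hM.inC0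
  have hfree : ∀ P : Set V, M.FreeOver n m ∅ P := fun P E _ hEs _ _ => by
    rw [freelyAmalgamated_iff, Set.empty_union]
    exact ⟨hEs, fun e _ he => Or.inr he⟩
  obtain ⟨g, hg⟩ := exists_perm_of_backAndForth
    (p := M.IsApprox n m (A₁ ∪ C₁) (A₂ ∪ C₂) h) (f₀ := PartialEquiv.ofSet ∅)
    { finite := Set.finite_empty
      emb := M.isEmbOn_id ∅
      source := hempty
      target := hempty
      free_source := hfree _
      free_target := hfree _
      mem_iff := fun x hx => hx.elim
      eqOn := fun x hx => hx.1.elim }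
    (fun f hf b => by
      obtain ⟨f₁, hf₁, h1, hb₁⟩ := hf.forth hr hm hM H b
      -- The back step is the forth step for the inverse isomorphism.
      obtain ⟨f₂, hf₂, h2, hb₂⟩ := (hf₁.symm H.source_eq).forth hr hm hM H.symm b
      have h3 := h2.symm
      rw [f₁.symm_symm] at h3
      exact ⟨f₂.symm, hf₂.symm H.target_eq, h1.trans h3, h3.1 hb₁, hb₂⟩)
  refine ⟨g, mem_aut_of_isEmbOn ⟨g.injective.injOn, fun e _ => ?_⟩, fun x hx => ?_⟩
  · obtain ⟨f, hf, hs, hgf⟩ := hg e e.finite_toSet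
    rw [hf.emb.2 e hs, Finset.image_congr (fun x hx => hgf hx)]
  · obtain ⟨f, hf, hs, hgf⟩ := hg {x} (Set.finite_singleton x)
    rw [hgf rfl]
    exact hf.eqOn ⟨hs rfl, hx⟩

end Hypergraph

/-! ### Finite form of independence, and non-triviality of `d` -/

namespace IsDimensionFunction

variable {V : Type u} {G : Subgroup (Equiv.Perm V)} {d : Finset V → ℤ}

-- As I spans B, d(D/I) ≤ d(D/B) = d(D/C) ≤ d(D/E).
open scoped Classical in
theorem sub_le_sub_of_relDim_eq (hd : IsDimensionFunction G d) {D E I : Finset V} {B C : Set V}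
    (hID : I ⊆ D) (hB : B ⊆ dcl d I) (hE : (E : Set V) ⊆ C) (h : relDim d D C = relDim d D B) :
    d D - d I ≤ d (D ∪ E) - d E := by
  have h1 := hd.relDim_coe D I
  rw [Finset.union_eq_left.2 hID, ← hd.relDim_dcl] at h1
  have h2 := hd.relDim_anti D hB
  have h3 := hd.relDim_le D hE
  linarith

theorem setDim_dcl (hd : IsDimensionFunction G d) {A : Set V} (hA : A ∈ dClosures d) (Z : Set V) :
    setDim d A (dcl d Z) = setDim d A Z := by
  obtain ⟨X, hX, hAX⟩ := hd.exists_finset_of_mem hA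
  rw [hd.setDim_eq_relDim hX hAX, hd.setDim_eq_relDim hX hAX, hd.relDim_dcl]

end IsDimensionFunction

namespace Hypergraph

variable {r : ℕ} {V : Type u} {n m : ℕ} {M : Hypergraph r V}

/-- Genericity over ∅ realizes a single vertex as a self-sufficient set, and its dimension is n. -/
theorem IsGeneric.exists_dim_ne_zero (hr : 1 ≤ r) (hn : 1 ≤ n) (hM : M.IsGeneric n m) :
    ∃ X : Finset V, M.dim n m X ≠ 0 := by
  let A : Hypergraph r Unit := ⟨∅, fun _ h => h.elim⟩
  have hp : ∀ Z : Set Unit, A.predim n m Z = n * Z.ncard := fun Z => by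
    have : A.edgesIn Z = ∅ := Set.eq_empty_of_forall_notMem fun _ he => he.1
    simp [predim, this]
  obtain ⟨α, h1, -, h3⟩ := hM.extension ∅ Set.finite_empty (selfSufficient_empty hM.inC0) Unit A
    (fun X _ => ⟨Set.empty_subset _, fun B _ _ => by
      rw [hp, hp, Set.ncard_empty]
      positivity⟩)
    ⟨fun x => x.2.elim, fun x => x.2.elim⟩
    (fun e => by
      refine ⟨fun he => ?_, fun he => he.elim⟩
      have h1 := M.card_edge _ he
      have h2 : e = ∅ := Finset.eq_empty_of_forall_notMem fun x => x.2.elim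
      rw [h2, Finset.map_empty, Finset.card_empty] at h1
      omega)
    (selfSufficient_of_predim_inter_le fun Z _ => by
      rw [Set.range_eq_empty, Set.inter_empty, hp, hp, Set.ncard_empty]
      push_cast
      rw [mul_zero]
      positivity)
  refine ⟨{α ()}, ?_⟩
  have h4 : Set.range α = {α ()} := Set.range_unique
  rw [h4] at h3
  rw [dim_eq_setRank, Finset.coe_singleton, h3.setRank_eq, ← h4, ← Set.image_univ,
    (h1.isEmbOn Set.univ).predim_image le_rfl, hp, Set.ncard_univ, Nat.card_unique]
  push_cast
  omega

/-! ### Homogeneity and stationarity -/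

theorem IsIsoBetween.exists_isEmbOn {A₁ A₂ : Set V} {h : A₁ ≃ A₂} (hh : M.IsIsoBetween h) :
    ∃ k : V → V, (∀ a : A₁, k a = h a) ∧ M.IsEmbOn M k A₁ ∧ k '' A₁ = A₂ := by
  classical
  let k : V → V := fun x => if hx : x ∈ A₁ then h ⟨x, hx⟩ else x
  have hk : ∀ a : A₁, k a = h a := fun a => by simp [k]
  refine ⟨k, hk, ⟨?_, fun e he => ?_⟩, ?_⟩
  · intro x hx y hy hxy
    have h1 := hk ⟨x, hx⟩
    have h2 := hk ⟨y, hy⟩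
    simp only at h1 h2
    rw [h1, h2] at hxy
    exact congrArg Subtype.val (h.injective (Subtype.ext hxy))
  · obtain ⟨e', rfl⟩ : ∃ e' : Finset A₁, e'.image Subtype.val = e := by
      obtain ⟨e', -, h2⟩ := exists_finset_image_eq (f := (Subtype.val : A₁ → V))
        (X := Set.univ) (e := e) (by simpa using he)
      exact ⟨e', h2⟩
    rw [← (M.isEmbOn_subtype_val A₁ Set.univ).2 e' (Set.subset_univ _), hh e',
      (M.isEmbOn_subtype_val A₂ Set.univ).2 _ (Set.subset_univ _), Finset.map_eq_image,
      Finset.image_image, Finset.image_image, show k ∘ Subtype.val = _ from funext hk]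
    rfl
  · ext y
    constructor
    · rintro ⟨x, hx, rfl⟩
      rw [show k x = _ from hk ⟨x, hx⟩]
      exact (h _).2
    · intro hy
      refine ⟨h.symm ⟨y, hy⟩, (h.symm _).2, ?_⟩
      rw [hk, h.apply_symm_apply]

variable (hr : 1 ≤ r) (hm : 1 ≤ m) (hM : M.IsGeneric n m)
include hr hm hM

theorem IsEmbOn.exists_mem_aut [Nonempty V] {k : V → V} {A C : Set V} (hk : M.IsEmbOn M k (A ∪ C))
    (h₁ : M.IsTameAmalgam n m A C) (h₂ : M.IsTameAmalgam n m (k '' A) (k '' C)) :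
    ∃ g ∈ M.aut, Set.EqOn g k (A ∪ C) :=
  IsAmalgamIso.exists_mem_aut (h := hk.1.toPartialEquiv) hr hm hM
    ⟨rfl, hk, rfl, rfl, h₁, h₂⟩

omit hm in
theorem isTameAmalgam_of_mem_dClosures {A C : Set V} (hA : A ∈ dClosures (M.dim n m))
    (hC : C ∈ dClosures (M.dim n m)) (hs : M.SelfSufficient n m (A ∪ C))
    (hf : M.FreelyAmalgamated A C) : M.IsTameAmalgam n m A C := by
  have hd := isDimensionFunction_dim hM.inC0 hr
  have hA' := hd.dcl_eq_of_mem hA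
  have hC' := hd.dcl_eq_of_mem hC
  obtain ⟨X, hX⟩ := hd.dcl_union_mem hA hC
  exact ⟨selfSufficient_of_dcl_eq hr hM.inC0 hA', selfSufficient_of_dcl_eq hr hM.inC0 hC', hs, hf,
    Or.inr hA', Or.inr hC', X, hX ▸ hd.subset_dcl _⟩

theorem exists_mem_aut_of_isIsoBetween [Nonempty V] {A₁ A₂ : Set V}
    (hA₁ : A₁ ∈ dClosures (M.dim n m)) (hA₂ : A₂ ∈ dClosures (M.dim n m)) {h : A₁ ≃ A₂}
    (hh : M.IsIsoBetween h) : ∃ g ∈ M.aut, ∀ a : A₁, g a = h a := by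
  obtain ⟨k, hk, hke, rfl⟩ := hh.exists_isEmbOn
  have hd := isDimensionFunction_dim hM.inC0 hr
  have key : ∀ A ∈ dClosures (M.dim n m), M.IsTameAmalgam n m A ∅ := by
    intro A hA
    have hA' := hd.dcl_eq_of_mem hA
    have hs := selfSufficient_of_dcl_eq hr hM.inC0 hA'
    obtain ⟨X, hX⟩ := hA
    refine ⟨hs, selfSufficient_empty hM.inC0, by rwa [Set.union_empty], ?_, Or.inr hA',
      Or.inl Set.finite_empty, X, by rw [Set.union_empty, hX]⟩
    rw [freelyAmalgamated_iff, Set.union_empty]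
    exact fun e _ he => Or.inl he
  obtain ⟨g, hg, hgk⟩ := IsEmbOn.exists_mem_aut (C := ∅) hr hm hM (by rwa [Set.union_empty])
    (key A₁ hA₁) (by rw [Set.image_empty]; exact key _ hA₂)
  exact ⟨g, hg, fun a => by rw [hgk (Or.inl a.2), hk]⟩

/-- An isomorphism between `d`-closed sets which are freely amalgamated with `C` extends to an
automorphism which fixes `C` pointwise. -/
theorem IsEmbOn.exists_mem_aut_fixing [Nonempty V] {k : V → V} {A₁ A₂ C : Set V}
    (hk : M.IsEmbOn M k A₁) (hkA : k '' A₁ = A₂) (hA₁ : A₁ ∈ dClosures (M.dim n m))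
    (hA₂ : A₂ ∈ dClosures (M.dim n m)) (hC : C ∈ dClosures (M.dim n m))
    (hAC : A₂ ∩ C ⊆ A₁) (hid : ∀ x ∈ A₁ ∩ C, k x = x)
    (hs₁ : M.SelfSufficient n m (A₁ ∪ C)) (hs₂ : M.SelfSufficient n m (A₂ ∪ C))
    (hf₁ : M.FreelyAmalgamated A₁ C) (hf₂ : M.FreelyAmalgamated A₂ C) :
    ∃ g ∈ M.aut, Set.EqOn g k A₁ ∧ FixesPointwise g C := by
  obtain ⟨l, hl₁, hl₂, hl⟩ := hk.union (M.isEmbOn_id C) (fun x hx => hid x hx)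
    (fun x hx hxC => by
      rw [Set.image_id] at hxC
      -- If k x lies in C, then it is in A₁ ∩ C and hence fixed by k. Injectivity gives x = k x, so
      -- x is in C.
      have h1 : k x ∈ A₁ := hAC ⟨hkA ▸ Set.mem_image_of_mem k hx, hxC⟩
      have h2 := hk.1 h1 hx (hid _ ⟨h1, hxC⟩)
      rwa [h2] at hxC)
    hf₁ (by rw [hkA, Set.image_id]; exact hf₂)
  obtain ⟨g, hg, hgl⟩ := IsEmbOn.exists_mem_aut hr hm hM hl
    (isTameAmalgam_of_mem_dClosures hr hM hA₁ hC hs₁ hf₁)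
    (by
      rw [hl₁.image_eq, hl₂.image_eq, Set.image_id, hkA]
      exact isTameAmalgam_of_mem_dClosures hr hM hA₂ hC hs₂ hf₂)
  exact ⟨g, hg, fun x hx => by rw [hgl (Or.inl hx), hl₁ hx],
    fun x hx => by rw [hgl (Or.inr hx), hl₂ hx]; rfl⟩

/-- Independent `d`-closed sets are freely amalgamated and their union is self-sufficient. -/
theorem selfSufficient_union_and_free_of_setDim_eq {A B C : Set V}
    (hA : A ∈ dClosures (M.dim n m)) (hB : B ∈ dClosures (M.dim n m))
    (hC : C ∈ dClosures (M.dim n m)) (hBA : B ⊆ A) (hBC : B ⊆ C)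
    (h : setDim (M.dim n m) A C = setDim (M.dim n m) A B) :
    M.SelfSufficient n m (A ∪ C) ∧ M.FreelyAmalgamated A C := by
  classical
  have hd := isDimensionFunction_dim hM.inC0 hr
  obtain ⟨X, hX, hAX⟩ := hd.exists_finset_of_mem hA
  obtain ⟨Y, hY, hBY⟩ := hd.exists_finset_of_mem hB
  have hAs := selfSufficient_of_dcl_eq hr hM.inC0 (hd.dcl_eq_of_mem hA)
  have hCs := selfSufficient_of_dcl_eq hr hM.inC0 (hd.dcl_eq_of_mem hC)
  refine selfSufficient_union_and_freelyAmalgamated hM.inC0 fun S hS hSAC => ?_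
  -- Closing S together with sets spanning A and B makes Z ∩ A span A and Z ∩ A ∩ C span B, as the
  -- finite form of independence requires.
  obtain ⟨hZf, hZ, hsub⟩ := cl0_spec hM.inC0 (hS.union (X ∪ Y).finite_toSet)
  generalize M.cl0 n m (S ∪ ((X ∪ Y : Finset V) : Set V)) = Z at hZf hZ hsub
  rw [Finset.coe_union] at hsub
  have hSZ : S ⊆ Z := Set.subset_union_left.trans hsub
  have hXZ : (X : Set V) ⊆ Z := (Set.subset_union_left.trans Set.subset_union_right).trans hsub
  have hYZ : (Y : Set V) ⊆ Z := (Set.subset_union_right.trans Set.subset_union_right).trans hsub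
  have hDs := hZ.inter hAs
  have hEs := hZ.inter hCs
  refine ⟨Z ∩ A, Z ∩ C, Set.inter_subset_right, Set.inter_subset_right, ?_, ?_⟩
  · rw [← Set.inter_union_distrib_left]
    exact Set.subset_inter hSZ hSAC
  have hXD : (X : Set V) ⊆ Z ∩ A := Set.subset_inter hXZ hX
  have hYDE : (Y : Set V) ⊆ (Z ∩ A) ∩ (Z ∩ C) := Set.subset_inter
    (Set.subset_inter hYZ (hY.trans hBA)) (Set.subset_inter hYZ (hY.trans hBC))
  have hDA : Z ∩ A ⊆ A := Set.inter_subset_right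
  have hEC : Z ∩ C ⊆ C := Set.inter_subset_right
  have hDf := hZf.inter_of_left A
  have hEf := hZf.inter_of_left C
  generalize Z ∩ A = D at *
  generalize Z ∩ C = E at *
  lift D to Finset V using hDf
  lift E to Finset V using hEf
  have hAD := hAX.trans (hd.dcl_mono hXD)
  rw [hd.setDim_eq_relDim hDA hAD, hd.setDim_eq_relDim hDA hAD] at h
  have h1 := hd.sub_le_sub_of_relDim_eq (I := D ∩ E) Finset.inter_subset_left
    (hBY.trans (hd.dcl_mono (by rwa [Finset.coe_inter]))) hEC h
  refine selfSufficient_union_and_free_of_predim_le hm hM.inC0 D.finite_toSet E.finite_toSet ?_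
  have h2 := setRank_le_predim (n := n) (m := m) hM.inC0 (le_refl ((D : Set V) ∩ E))
    (D.finite_toSet.inter_of_left _)
  simp only [dim_eq_setRank, hDs.setRank_eq, hEs.setRank_eq, Finset.coe_union,
    Finset.coe_inter] at h1
  linarith

/-- C need not contain B. Passing to cl^d(B ∪ C) preserves independence, makes the intersection with
each Aᵢ exactly B, and reduces the claim to gluing h with the identity. -/
theorem stationaryIndep [Nonempty V] : StationaryIndep M.aut (M.dim n m) := by
  intro A₁ hA₁ A₂ hA₂ B hB C hC hBA₁ hBA₂ hi₁ hi₂ h hid hpa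
  obtain ⟨-, -, σ, hσ, hσh⟩ := hpa
  have hd := isDimensionFunction_dim hM.inC0 hr
  have hC' := hd.dcl_union_mem hB hC
  have hBC' : B ⊆ dcl (M.dim n m) (B ∪ C) := Set.subset_union_left.trans (hd.subset_dcl _)
  have hCC' : C ⊆ dcl (M.dim n m) (B ∪ C) := Set.subset_union_right.trans (hd.subset_dcl _)
  have key : ∀ A ∈ dClosures (M.dim n m), B ⊆ A → DIndep (M.dim n m) A B C →
      M.SelfSufficient n m (A ∪ dcl (M.dim n m) (B ∪ C)) ∧
      M.FreelyAmalgamated A (dcl (M.dim n m) (B ∪ C)) ∧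
      A ∩ dcl (M.dim n m) (B ∪ C) ⊆ B := by
    intro A hA hBA hi
    have h1 : setDim (M.dim n m) A (dcl (M.dim n m) (B ∪ C)) = setDim (M.dim n m) A B := by
      rw [hd.setDim_dcl hA]
      exact hi
    obtain ⟨h2, h3⟩ :=
      selfSufficient_union_and_free_of_setDim_eq hr hm hM hA hB hC' hBA hBC' h1
    refine ⟨h2, h3, fun a ha => ?_⟩
    obtain ⟨X, hX, hAX⟩ := hd.exists_finset_of_mem hA
    have h4 : DIndep (M.dim n m) A B (dcl (M.dim n m) (B ∪ C)) := by
      rw [DIndep, Set.union_eq_right.2 hBC', h1]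
    have h5 := hd.mem_dcl_of_dIndep hX hAX h4 ha.1 ha.2
    rwa [hd.dcl_eq_of_mem hB] at h5
  obtain ⟨s₁, f₁, i₁⟩ := key A₁ hA₁ hBA₁ hi₁
  obtain ⟨s₂, f₂, i₂⟩ := key A₂ hA₂ hBA₂ hi₂
  have hσA : σ '' A₁ = A₂ := by
    ext y
    constructor
    · rintro ⟨x, hx, rfl⟩
      rw [hσh ⟨x, hx⟩]
      exact (h _).2
    · intro hy
      refine ⟨h.symm ⟨y, hy⟩, (h.symm _).2, ?_⟩
      rw [hσh, h.apply_symm_apply]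
  obtain ⟨g, hg, hgσ, hgC⟩ := (isEmbOn_of_mem_aut hσ A₁).exists_mem_aut_fixing hr hm hM hσA hA₁ hA₂
    hC' (i₂.trans hBA₁)
    (fun x hx => by rw [hσh ⟨x, hx.1⟩, hid ⟨x, hx.1⟩ (i₁ hx)])
    s₁ s₂ f₁ f₂
  have hD := hd.dcl_union_mem hA₁ hC'
  refine ⟨_, _, g.image (dcl (M.dim n m) (A₁ ∪ dcl (M.dim n m) (B ∪ C))),
    ⟨hD, hd.image_mem_dClosures hg hD, g, hg, fun a => rfl⟩, fun a => ?_, fun c hc => ?_⟩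
  · exact ⟨hd.subset_dcl _ (Or.inl a.2), (hgσ a.2).trans (hσh a)⟩
  · exact ⟨hd.subset_dcl _ (Or.inr (hCC' hc)), hgC c (hCC' hc)⟩

end Hypergraph

namespace Hypergraph

variable {r : ℕ} {V : Type u} {n m : ℕ} {M : Hypergraph r V}

/-! ### Free doubling and the existence of independent copies -/

section Double

open scoped Classical in
/-- The second copy of `V` in the double of `V` over `B`. -/
noncomputable def dblRight (B : Set V) (x : V) : V ⊕ V := if x ∈ B then Sum.inl x else Sum.inr x

theorem elim_dblRight (B : Set V) (x : V) : Sum.elim id id (dblRight B x) = x := by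
  unfold dblRight
  split_ifs <;> rfl

theorem dblRight_injective (B : Set V) : Function.Injective (dblRight B) :=
  Function.LeftInverse.injective (elim_dblRight B)

theorem dblRight_of_mem {B : Set V} {x : V} (hx : x ∈ B) : dblRight B x = Sum.inl x := if_pos hx

theorem dblRight_eq_inl_iff {B : Set V} {x y : V} :
    dblRight B x = Sum.inl y ↔ x ∈ B ∧ x = y := by
  unfold dblRight
  split_ifs with h <;> simp [h]

/-- The free amalgam of two copies of `M` over `B`; it lives on the union of the ranges of `Sum.inl`
and `dblRight B`. -/
def double (M : Hypergraph r V) (B : Set V) : Hypergraph r (V ⊕ V) where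
  edges := {e | ∃ s ∈ M.edges,
    (e : Set (V ⊕ V)) = Sum.inl '' (s : Set V) ∨ (e : Set (V ⊕ V)) = dblRight B '' (s : Set V)}
  card_edge := by
    rintro e ⟨s, hs, h | h⟩
    · rw [← M.card_edge s hs, ← Set.ncard_coe_finset, h, Sum.inl_injective.injOn.ncard_image,
        Set.ncard_coe_finset]
    · rw [← M.card_edge s hs, ← Set.ncard_coe_finset, h,
        (dblRight_injective B).injOn.ncard_image, Set.ncard_coe_finset]

theorem isEmbOn_double {B : Set V} {f : V → V ⊕ V} (hf : f = Sum.inl ∨ f = dblRight B) :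
    M.IsEmbOn (M.double B) f Set.univ := by
  have hl : ∀ x, Sum.elim id id (f x) = x := by
    rcases hf with rfl | rfl
    · exact fun x => rfl
    · exact elim_dblRight B
  have hl' : ∀ (g : V → V ⊕ V), (∀ x, Sum.elim id id (g x) = x) → ∀ s : Set V,
      Sum.elim id id '' (g '' s) = s := by
    intro g hg s
    rw [Set.image_image, Set.image_congr fun x _ => hg x, Set.image_id']
  refine isEmbOn_of_coe_eq (Function.LeftInverse.injective hl).injOn fun e e' _ hee =>
    ⟨fun he => ⟨e, he, ?_⟩, ?_⟩
  · exact hf.imp (fun h => by rw [hee, h]) (fun h => by rw [hee, h])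
  · rintro ⟨s, hs, h⟩
    rw [hee] at h
    have h1 : (e : Set V) = s := by
      rcases h with h | h
      · have h1 := congrArg (Set.image (Sum.elim id id)) h
        rwa [hl' f hl, hl' _ fun _ => rfl] at h1
      · have h1 := congrArg (Set.image (Sum.elim id id)) h
        rwa [hl' f hl, hl' _ (elim_dblRight B)] at h1
    rwa [Finset.coe_injective h1]

theorem freelyAmalgamated_double (M : Hypergraph r V) (B : Set V) :
    (M.double B).FreelyAmalgamated (Set.range Sum.inl) (Set.range (dblRight B)) := by
  rw [freelyAmalgamated_iff]
  rintro e ⟨s, hs, h | h⟩ -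
  · exact Or.inl (h ▸ Set.image_subset_range _ _)
  · exact Or.inr (h ▸ Set.image_subset_range _ _)

theorem range_inl_inter_range_dblRight (B : Set V) :
    Set.range Sum.inl ∩ Set.range (dblRight B) = Sum.inl '' B := by
  ext u
  constructor
  · rintro ⟨⟨x, rfl⟩, y, hy⟩
    rw [dblRight_eq_inl_iff] at hy
    obtain ⟨h1, rfl⟩ := hy
    exact ⟨y, h1, rfl⟩
  · rintro ⟨x, hx, rfl⟩
    exact ⟨⟨x, rfl⟩, x, dblRight_of_mem hx⟩

/-- Self-sufficiency of B carries over to each copy. Combined with the additivity in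
`predim_double_add`, it makes each copy self-sufficient in the double. -/
theorem predim_double_inter_range_le {B : Set V} (hB : M.SelfSufficient n m B) {f : V → V ⊕ V}
    (hf : f = Sum.inl ∨ f = dblRight B) {S : Set (V ⊕ V)} (hS : S.Finite) :
    (M.double B).predim n m (S ∩ Sum.inl '' B) ≤ (M.double B).predim n m (S ∩ Set.range f) := by
  have hemb := isEmbOn_double (M := M) hf
  have hfB : Sum.inl '' B = f '' B := by
    rcases hf with rfl | rfl
    · rfl
    · exact Set.image_congr fun x hx => (dblRight_of_mem hx).symm
  have h1 : S ∩ Set.range f = f '' (f ⁻¹' S) := by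
    rw [Set.image_preimage_eq_inter_range]
  have h2 : S ∩ Sum.inl '' B = f '' (f ⁻¹' S ∩ B) := by
    rw [hfB, Set.inter_comm (f ⁻¹' S), Set.image_inter_preimage, Set.inter_comm]
  rw [h1, h2, hemb.predim_image (Set.subset_univ _), hemb.predim_image (Set.subset_univ _)]
  exact hB.predim_inter_le (hS.preimage (hemb.1.mono (Set.subset_univ _)))

theorem predim_double_add {S : Set (V ⊕ V)} (B : Set V) (hS : S.Finite)
    (hSr : S ⊆ Set.range Sum.inl ∪ Set.range (dblRight B)) :
    (M.double B).predim n m S + (M.double B).predim n m (S ∩ Sum.inl '' B) =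
      (M.double B).predim n m (S ∩ Set.range Sum.inl) +
      (M.double B).predim n m (S ∩ Set.range (dblRight B)) := by
  have h := ((M.freelyAmalgamated_double B).inter S).predim_union_add_inter (n := n) (m := m)
    (hS.inter_of_left _) (hS.inter_of_left _)
  rwa [← Set.inter_union_distrib_left, ← Set.inter_inter_distrib_left,
    Set.inter_eq_left.2 hSr, range_inl_inter_range_dblRight] at h

/-- A finite self-sufficient set has a copy over its intersection with `B` which is independent from
it. -/
theorem IsGeneric.exists_independent_copy [Nonempty V] (hr : 1 ≤ r) (hM : M.IsGeneric n m)
    {B Z : Set V} (hB : M.SelfSufficient n m B) (hZ : Z.Finite) (hZs : M.SelfSufficient n m Z) :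
    ∃ τ : V → V, M.IsEmbOn M τ Z ∧ (∀ x ∈ Z ∩ B, τ x = x) ∧ M.SelfSufficient n m (τ '' Z) ∧
      M.SelfSufficient n m (Z ∪ τ '' Z) ∧
      M.predim n m (Z ∪ τ '' Z) + M.predim n m (Z ∩ B) =
        M.predim n m Z + M.predim n m (τ '' Z) := by
  have e₁ := isEmbOn_double (M := M) (B := B) (Or.inl rfl)
  have e₂ := isEmbOn_double (M := M) (B := B) (Or.inr rfl)
  let T : Set (V ⊕ V) := Sum.inl '' Z ∪ dblRight B '' Z
  have hT : T.Finite := (hZ.image _).union (hZ.image _)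
  have hTr : T ⊆ Set.range Sum.inl ∪ Set.range (dblRight B) :=
    Set.union_subset_union (Set.image_subset_range _ _) (Set.image_subset_range _ _)
  have hT₁ : T ∩ Set.range Sum.inl = Sum.inl '' Z := by
    ext u
    constructor
    · rintro ⟨h | ⟨x, hx, rfl⟩, y, hy⟩
      · exact h
      · rw [eq_comm, dblRight_eq_inl_iff] at hy
        exact ⟨x, hx, (dblRight_of_mem hy.1).symm⟩
    · rintro ⟨x, hx, rfl⟩
      exact ⟨Or.inl ⟨x, hx, rfl⟩, x, rfl⟩
  have hT₂ : T ∩ Set.range (dblRight B) = dblRight B '' Z := by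
    ext u
    constructor
    · rintro ⟨⟨x, hx, rfl⟩ | h, y, hy⟩
      · rw [dblRight_eq_inl_iff] at hy
        obtain ⟨h1, rfl⟩ := hy
        exact ⟨y, hx, dblRight_of_mem h1⟩
      · exact h
    · rintro ⟨x, hx, rfl⟩
      exact ⟨Or.inr ⟨x, hx, rfl⟩, x, rfl⟩
  have hT₀ : T ∩ Sum.inl '' B = Sum.inl '' (Z ∩ B) := by
    rw [← range_inl_inter_range_dblRight, ← Set.inter_assoc, hT₁]
    ext u
    constructor
    · rintro ⟨⟨x, hx, rfl⟩, y, hy⟩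
      rw [dblRight_eq_inl_iff] at hy
      obtain ⟨h1, rfl⟩ := hy
      exact ⟨y, ⟨hx, h1⟩, rfl⟩
    · rintro ⟨x, ⟨hx, hxB⟩, rfl⟩
      exact ⟨⟨x, hx, rfl⟩, x, dblRight_of_mem hxB⟩
  have hle : ∀ S ⊆ T, (M.double B).predim n m (S ∩ Set.range Sum.inl) ≤
      (M.double B).predim n m S ∧ (M.double B).predim n m (S ∩ Set.range (dblRight B)) ≤
      (M.double B).predim n m S := by
    intro S hS
    have h1 := predim_double_inter_range_le hB (Or.inl rfl) (hT.subset hS)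
    have h2 := predim_double_inter_range_le hB (Or.inr rfl) (hT.subset hS)
    have h3 := predim_double_add (M := M) (n := n) (m := m) B (hT.subset hS) (hS.trans hTr)
    constructor <;> linarith
  obtain ⟨α, h1, h2, h3⟩ := hM.exists_extension hT
    (fun S hS => by
      refine le_trans ?_ (hle S hS).1
      rw [← Set.image_preimage_eq_inter_range, e₁.predim_image (Set.subset_univ _),
        predim_empty hr, ← predim_empty hr M]
      have hf := (hT.subset hS).preimage (Sum.inl_injective.injOn (s := Sum.inl ⁻¹' S))
      exact (hM.inC0 _ hf).2 _ (Set.empty_subset _) le_rfl)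
    hZ hZs (e₁.mono (Set.subset_univ Z)) Set.subset_union_left
    (fun S hS => by
      rw [← hT₁, ← Set.inter_assoc, Set.inter_eq_left.2 hS]
      exact (hle S hS).1)
  have himg : α '' T = Z ∪ (α ∘ dblRight B) '' Z := by
    rw [Set.image_union, Set.image_image, Set.image_comp, Set.image_congr h2, Set.image_id']
  have hsub₂ : dblRight B '' Z ⊆ T := Set.subset_union_right
  refine ⟨α ∘ dblRight B, (h1.mono hsub₂).comp (e₂.mono (Set.subset_univ Z)), ?_, ?_, ?_, ?_⟩
  · rintro x ⟨hx, hxB⟩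
    rw [Function.comp_apply, dblRight_of_mem hxB, h2 x hx]
  · rw [Set.image_comp]
    refine h1.selfSufficient_image_of_predim_le h3 (hZ.image _) hsub₂ fun S _ hZS hST => ?_
    have h4 : S ∩ Set.range (dblRight B) = dblRight B '' Z :=
      (hT₂ ▸ Set.inter_subset_inter_left _ hST).antisymm
        (Set.subset_inter hZS (Set.image_subset_range _ _))
    rw [← h4]
    exact (hle S hST).2
  · rwa [← himg]
  · have h4 := predim_double_add (M := M) (n := n) (m := m) B hT hTr
    rw [hT₁, hT₂, hT₀, e₁.predim_image (Set.subset_univ _), e₁.predim_image (Set.subset_univ _),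
      ← h1.predim_image hsub₂, ← h1.predim_image le_rfl, himg, ← Set.image_comp] at h4
    exact h4

end Double

theorem isTameAmalgam_of_finite (hr : 1 ≤ r) (hm : 1 ≤ m) (hM : M.IsGeneric n m) {Z B : Set V}
    (hZ : Z.Finite) (hZs : M.SelfSufficient n m Z) (hB : dcl (M.dim n m) B = B)
    (hBZ : B ⊆ dcl (M.dim n m) (Z ∩ B)) : M.IsTameAmalgam n m Z B := by
  have hd := isDimensionFunction_dim hM.inC0 hr
  have hBs := selfSufficient_of_dcl_eq hr hM.inC0 hB
  obtain ⟨h1, h2⟩ := (freeOver_of_subset_dcl hr hm hM.inC0 hZ hZs hBs hBZ).union hM.inC0 hZ hBs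
  refine ⟨hZs, hBs, h1, h2, Or.inl hZ, Or.inr hB, hZ.toFinset, ?_⟩
  rw [hZ.coe_toFinset]
  exact Set.union_subset (hd.subset_dcl Z) (hBZ.trans (hd.dcl_mono Set.inter_subset_left))

/-- The free copy τ(Z) is independent from Z over Z ∩ B. It remains to realize τ by an automorphism
fixing the whole of B, which works because Z ∩ B spans B. -/
theorem existence [Nonempty V] (hr : 1 ≤ r) (hm : 1 ≤ m) (hM : M.IsGeneric n m) :
    Existence M.aut (M.dim n m) := by
  classical
  intro A hA B hB C hC
  have hd := isDimensionFunction_dim hM.inC0 hr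
  obtain ⟨X, hX, hAX⟩ := hd.exists_finset_of_mem hA
  obtain ⟨Y, hY, hBY⟩ := hd.exists_finset_of_mem hB
  obtain ⟨X', hX', hCX'⟩ := hd.exists_finset_of_mem hC
  have hBc := hd.dcl_eq_of_mem hB
  have hBs := selfSufficient_of_dcl_eq hr hM.inC0 hBc
  obtain ⟨hZ, hZs, hsub⟩ := cl0_spec hM.inC0 (X ∪ (Y ∪ X')).finite_toSet
  generalize M.cl0 n m ((X ∪ (Y ∪ X') : Finset V) : Set V) = Z at hZ hZs hsub
  rw [Finset.coe_union, Finset.coe_union, Set.union_subset_iff, Set.union_subset_iff] at hsub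
  obtain ⟨hXZ, hYZ, hX'Z⟩ := hsub
  have hBZ : B ⊆ dcl (M.dim n m) (Z ∩ B) := hBY.trans (hd.dcl_mono (Set.subset_inter hYZ hY))
  obtain ⟨τ, hτ, hτB, hτs, hτu, hδ⟩ := hM.exists_independent_copy hr hBs hZ hZs
  have hZB : Z ∩ B ⊆ τ '' Z ∩ B := fun x hx => ⟨⟨x, hx.1, hτB x hx⟩, hx.2⟩
  -- The copy could meet B outside Z ∩ B. The points of Z sent into B form a set with the same δ as
  -- Z ∩ B, so they lie in cl^d(Z ∩ B) and hence in B.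
  have hmem : ∀ x ∈ Z, τ x ∈ B → x ∈ B := by
    obtain ⟨S, hS, hSτ⟩ := Set.subset_image_iff.1 (Set.inter_subset_left : τ '' Z ∩ B ⊆ τ '' Z)
    have h1 := predim_eq_of_subset_dcl hr hM.inC0 ((hZ.image τ).inter_of_left B) hZB
      (hτs.inter hBs) (hZs.inter hBs) (Set.inter_subset_right.trans hBZ)
    rw [← hSτ, hτ.predim_image hS] at h1
    have h2 : ∀ x ∈ Z, τ x ∈ B → x ∈ S := fun x hx hxB =>
      (hτ.1.mem_image_iff hS hx).1 (hSτ ▸ ⟨⟨x, hx, rfl⟩, hxB⟩)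
    intro x hx hxB
    rw [← hBc]
    refine hd.dcl_mono Set.inter_subset_right (mem_dcl_of_predim_le hr hM.inC0 (hZs.inter hBs)
      (hZ.subset hS) (fun y hy => h2 y hy.1 ?_) h1.le (h2 x hx hxB))
    rw [hτB y hy]
    exact hy.2
  have t₁ := isTameAmalgam_of_finite hr hm hM hZ hZs hBc hBZ
  have t₂ := isTameAmalgam_of_finite hr hm hM (hZ.image τ) hτs hBc (hBZ.trans (hd.dcl_mono hZB))
  obtain ⟨k, hk₁, hk₂, hk⟩ := hτ.union (M.isEmbOn_id B) hτB
    (fun x hx hxB => hmem x hx (by rwa [Set.image_id] at hxB)) t₁.free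
    (by rw [Set.image_id]; exact t₂.free)
  obtain ⟨g, hg, hgk⟩ := hk.exists_mem_aut hr hm hM t₁ (by
    rw [hk₁.image_eq, hk₂.image_eq, Set.image_id]
    exact t₂)
  refine ⟨g, hg, fun b hb => by rw [hgk (Or.inr hb), hk₂ hb]; rfl, ?_⟩
  have hgX : ((X.map g.toEmbedding : Finset V) : Set V) ⊆ g '' A := by
    rw [Finset.coe_map]
    exact Set.image_mono hX
  have hgAX : g '' A ⊆ dcl (M.dim n m) (X.map g.toEmbedding : Finset V) := by
    rw [Finset.coe_map, show (g.toEmbedding : V → V) = g from rfl, hd.dcl_image hg]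
    exact Set.image_mono hAX
  have hgZ : ((X.map g.toEmbedding : Finset V) : Set V) ⊆ τ '' Z := by
    rw [Finset.coe_map]
    rintro _ ⟨x, hx, rfl⟩
    have hxZ := hXZ hx
    exact ⟨x, hxZ, by rw [← hk₁ hxZ, ← hgk (Or.inl hxZ)]; rfl⟩
  rw [DIndep, hd.setDim_eq_relDim hgX hgAX, hd.setDim_eq_relDim hgX hgAX]
  generalize X.map g.toEmbedding = D at hgZ
  refine (hd.relDim_anti D Set.subset_union_left).antisymm ?_
  have hBC : B ∪ C ⊆ dcl (M.dim n m) Z := Set.union_subset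
    (hBZ.trans (hd.dcl_mono Set.inter_subset_left)) (hCX'.trans (hd.dcl_mono hX'Z))
  refine le_trans ?_ (hd.relDim_anti D hBC)
  rw [hd.relDim_dcl]
  refine (hd.relDim_anti D (Set.inter_subset_right : Z ∩ B ⊆ B)).trans ?_
  have hZ'f := hZ.image τ
  have hIs := hZs.inter hBs
  have hIf := hZ.inter_of_left B
  have hIZ : Z ∩ B ⊆ Z := Set.inter_subset_left
  have hIZ' : Z ∩ B ⊆ τ '' Z := hZB.trans Set.inter_subset_left
  rw [← hτu.setRank_eq, ← hIs.setRank_eq, ← hZs.setRank_eq, ← hτs.setRank_eq] at hδ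
  generalize Z ∩ B = I at *
  generalize τ '' Z = Z' at *
  lift I to Finset V using hIf
  lift Z to Finset V using hZ
  lift Z' to Finset V using hZ'f
  rw [hd.relDim_coe, hd.relDim_coe]
  -- Submodularity passes the independence of Z' from Z over I to the subset D of Z'.
  have h1 := hd.union_add_le (X := D ∪ Z) (Y := Z') (Z := D ∪ I)
    (Finset.subset_inter (Finset.union_subset_union_right (Finset.coe_subset.1 hIZ))
      (Finset.union_subset (Finset.coe_subset.1 hgZ) (Finset.coe_subset.1 hIZ')))
  have h2 := hd.le_of_subset (X := Z ∪ Z') (Y := D ∪ Z ∪ Z')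
    (Finset.union_subset_union_left Finset.subset_union_right)
  rw [← Finset.coe_union] at hδ
  simp only [← dim_eq_setRank] at hδ
  linarith

end Hypergraph

end Hrushovski
-- The main theorem
open Hrushovski
theorem corollary4p8 {r n m : ℕ} (hr : 2 ≤ r) (hn : 1 ≤ n) (hm : 1 ≤ m) (hnm : Nat.Coprime n m)
    {V : Type*} (M : Hypergraph r V) (hM : M.IsGeneric n m) :
    -- `d`-homogeneity
    (∀ A₁ ∈ dClosures (M.dim n m), ∀ A₂ ∈ dClosures (M.dim n m),
      ∀ h : A₁ ≃ A₂, M.IsIsoBetween h → ∃ g ∈ M.aut, ∀ a : A₁, g a = h a) ∧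
    -- `d`-stationarity
    (∀ A₁ ∈ dClosures (M.dim n m), ∀ A₂ ∈ dClosures (M.dim n m), ∀ C ∈ dClosures (M.dim n m),
      ∀ B : Set V, A₁ ∩ C = B → A₂ ∩ C = B →
      M.SelfSufficient n m (A₁ ∪ C) → M.SelfSufficient n m (A₂ ∪ C) →
      M.FreelyAmalgamated A₁ C → M.FreelyAmalgamated A₂ C →
      ∀ h : A₁ ≃ A₂, M.IsIsoBetween h → (∀ a : A₁, (a : V) ∈ B → (h a : V) = a) →
      ∃ g ∈ M.aut, (∀ a : A₁, g a = h a) ∧ FixesPointwise g C) ∧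
    -- `d` is a non-zero dimension function
    IsDimensionFunction M.aut (M.dim n m) ∧
    (∃ X : Finset V, M.dim n m X ≠ 0) ∧
    -- `cl^d` subsumes definable closure and `d`-independence satisfies Existence
    SubsumesDefinableClosure M.aut (M.dim n m) ∧
    Existence M.aut (M.dim n m) ∧
    -- `d`-independence is stationary
    StationaryIndep M.aut (M.dim n m) := by
  have hr' : 1 ≤ r := (by norm_num : 1 ≤ 2).trans hr
  have hex := hM.exists_dim_ne_zero hr' hn
  have hd := Hypergraph.isDimensionFunction_dim hM.inC0 hr'
  -- A nonzero value of d cannot occur on an empty vertex set, since d(∅) = 0.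
  have : Nonempty V := by
    obtain ⟨X, hX⟩ := hex
    by_contra hV
    rw [not_nonempty_iff] at hV
    exact hX (by rw [Finset.eq_empty_of_isEmpty X, hd.empty])
  have hexist := Hypergraph.existence hr' hm hM
  refine ⟨fun A₁ hA₁ A₂ hA₂ h hh => Hypergraph.exists_mem_aut_of_isIsoBetween hr' hm hM hA₁ hA₂ hh,
    ?_, hd, hex, hd.subsumesDefinableClosure hexist, hexist,
    Hypergraph.stationaryIndep hr' hm hM⟩
  intro A₁ hA₁ A₂ hA₂ C hC B hB₁ hB₂ hs₁ hs₂ hf₁ hf₂ h hh hid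
  obtain ⟨k, hk, hke, hkA⟩ := hh.exists_isEmbOn
  obtain ⟨g, hg, hgk, hgC⟩ := hke.exists_mem_aut_fixing hr' hm hM hkA hA₁ hA₂ hC
    (by rw [hB₂, ← hB₁]; exact Set.inter_subset_left)
    (fun x hx => by rw [hk ⟨x, hx.1⟩, hid ⟨x, hx.1⟩ (hB₁ ▸ hx)]) hs₁ hs₂ hf₁ hf₂
  exact ⟨g, hg, fun a => by rw [hgk a.2, hk], hgC⟩
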